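/- **Setting.** Let $G(\mathcal N,\mathcal E)$ be a connected finite graph of buses $i\in\mathcal N$ and arbitrarily oriented lines $ij\in\mathcal E\subset\mathcal N\times\mathcal N$ (if $ij\in\mathcal E$ then $ji\notin\mathcal E$). The buses are split into generator buses $\mathcal G$ and load buses $\mathcal L=\mathcal N\setminus\mathcal G$, and are partitioned into control areas; $\mathcal E_{in}\subset\mathcal E$ is the set of lines with both ends in the same area. Let $B_{ij}>0$ ($ij\in\mathcal E$), $M_i>0$ ($i\in\mathcal G$), $D_i>0$ and $P_i^{in}\in\mathbb R$ ($i\in\mathcal N$) be constants, $c_i:\mathbb R\to\mathbb R$ cost functions, $\underline d_i,\overline d_i$ load limits and $\underline P_{ij},\overline P_{ij}$ thermal limits. Write $$F_i(P)=\sum_{j:ij\in\mathcal E}P_{ij}-\sum_{k:ki\in\mathcal E}P_{ki},\qquad V_i(\psi)=\sum_{j:ij\in\mathcal E_{in}}B_{ij}(\psi_i-\psi_j)-\sum_{k:ki\in\mathcal E_{in}}B_{ki}(\psi_k-\psi_i).$$ Consider the problem $$\text{(op)}\quad \min_{d,\omega,P,\psi}\ \sum_{i}c_i(d_i)+\sum_i\tfrac12D_i\omega_i^2$$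 subject to $d_i=P^{in}_i-D_i\omega_i-F_i(P)$, $\underline d_i\le d_i\le\overline d_i$ and $d_i=P_i^{in}-V_i(\psi)$ for $i\in\mathcal N$, and $\underline P_{ij}\le B_{ij}(\psi_i-\psi_j)\le\overline P_{ij}$ for $ij\in\mathcal E_{in}$. **Assumptions.** There are $d,\theta\in\mathbb R^{\mathcal N}$ with $d_i=P_i^{in}-V_i(\theta)$, $\underline d_i\le d_i\le\overline d_i$ for all $i$ and $\underline P_{ij}\le B_{ij}(\theta_i-\theta_j)\le\overline P_{ij}$ for $ij\in\mathcal E_{in}$. Each $c_i$ is twice differentiable with $u\le c_i''\le\ell$ on $\mathbb R$, where $0<u\le\ell$. The controller uses $\tilde D_i=D_i+\delta a_i$ in place of $D_i$, where, with $\underline d'=1/\ell$ and $D_{\min}=\min_iD_i$, $$2\Big(\underline d'-\sqrt{\underline d'^2+\underline d'D_{\min}}\Big)<\delta a_i<2\Big(\underline d'+\sqrt{\underline d'^2+\underline d'D_{\min}}\Big)\qquad(i\in\mathcal N).$$ **Closed loop.** Let $K_i$ and all $\epsilon$'s be positive constants, with $\epsilon_{\omega_i}=1/M_i$ for $i\in\mathcal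 G$; let $\eta_i=(\epsilon_{\omega_i}+\epsilon_{\mu_i})/\epsilon_{\omega_i}$ and $\mu_i=\frac{\epsilon_{\mu_i}}{\epsilon_{\omega_i}}\omega_i+\frac{\epsilon_{\mu_i}}{K_i}r_i$ for $i\in\mathcal G$, and $\eta_i=1$ and $\mu_i=\frac{\epsilon_{\mu_i}}{K_i}r_i$ for $i\in\mathcal L$. Let $[x]^+_y=x$ if $x>0$ or $y>0$, and $[x]^+_y=0$ otherwise. The closed loop, with the $d$-update made instantaneously (infinite step size), is $$\begin{aligned} M_i\dot\omega_i&=-(D_i\omega_i+d_i-P_i^{in}+F_i(P))\ (i\in\mathcal G),\qquad 0=D_i\omega_i+d_i-P_i^{in}+F_i(P)\ (i\in\mathcal L),\\ \dot P_{ij}&=B_{ij}(\omega_i-\omega_j)\ (ij\in\mathcal E),\\ 0&=-c_i'(d_i)+\eta_i\omega_i+\tfrac{\epsilon_{\mu_i}}{K_i}r_i-\gamma_i^++\gamma_i^-\ (i\in\mathcal N),\\ \dot\psi_i&=\epsilon_{\psi_i}\Big[\sum_{j:ij\in\mathcal E_{in}}(\mu_i-\mu_j-\sigma^+_{ij}+\sigma^-_{ij})B_{ij}+\sum_{k:ki\in\mathcal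 E_{in}}(\mu_i-\mu_k+\sigma^+_{ki}-\sigma^-_{ki})B_{ki}\Big]\ (i\in\mathcal N),\\ \dot\gamma^+_i&=\epsilon_{\gamma_i^+}[d_i-\overline d_i]^+_{\gamma_i^+},\qquad \dot\gamma^-_i=\epsilon_{\gamma_i^-}[-d_i+\underline d_i]^+_{\gamma_i^-}\ (i\in\mathcal N),\\ \dot r_i&=K_i\big[\tilde D_i\omega_i+F_i(P)-V_i(\psi)\big]\ (i\in\mathcal N),\\ \dot\sigma^+_{ij}&=\epsilon_{\sigma_{ij}^+}[B_{ij}(\psi_i-\psi_j)-\overline P_{ij}]^+_{\sigma_{ij}^+},\qquad \dot\sigma^-_{ij}=\epsilon_{\sigma_{ij}^-}[-B_{ij}(\psi_i-\psi_j)+\underline P_{ij}]^+_{\sigma_{ij}^-}\ (ij\in\mathcal E_{in}). \end{aligned}$$ Solutions are understood in the sense of Carathéodory on $[0,\infty)$ (the differential equations hold in integrated form, the algebraic ones at every time). **Theorem.** Let $(d,\omega,P,\psi,\gamma,r,\sigma)(t)$, $t\ge0$, be any solution of the closed loop with $\gamma^\pm_i(0)=0$ and $\sigma^\pm_{ij}(0)\ge0$,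 along which the load limits are never hit, i.e. $\underline d_i<d_i(t)<\overline d_i$ for all $i\in\mathcal N$ and $t\ge0$. Then, as $t\to\infty$, it converges to a point $(d^*,\omega^*,P^*,\psi^*,\gamma^*,r^*,\sigma^*)$ such that $(d^*,\omega^*,P^*,\psi^*)$ is an optimal solution of (op). -/

import Mathlib

open Filter Topology MeasureTheory
open scoped BigOperators

/-- Data of a power network on the set `N` of buses, together with the data of the optimal load
control problem posed on it.  Lines are ordered pairs of buses (with an arbitrary orientation). -/
structure PowerSystem (N : Type*) [Fintype N] [DecidableEq N] where
  /-- the transmission lines -/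
  E : Finset (N × N)
  /-- each line carries only one of its two orientations (in particular there are no loops) -/
  E_asymm : ∀ i j, (i, j) ∈ E → (j, i) ∉ E
  /-- the underlying undirected graph is connected -/
  connected : (SimpleGraph.fromRel fun i j => (i, j) ∈ E).Connected
  /-- the generator buses; all other buses are load buses -/
  G : Finset N
  /-- label of the control area to which a bus belongs -/
  area : N → ℕ
  /-- line constants of the DC power flow model -/
  B : N → N → ℝ
  B_pos : ∀ i j, (i, j) ∈ E → 0 < B i j
  /-- generator inertia constants (meaningful at generator buses only) -/
  M : N → ℝ
  M_pos : ∀ i ∈ G, 0 < M i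
  /-- damping coefficients -/
  D : N → ℝ
  D_pos : ∀ i, 0 < D i
  /-- uncontrollable power injections -/
  Pin : N → ℝ
  /-- costs of load adjustment -/
  c : N → ℝ → ℝ
  /-- lower and upper load limits -/
  dlo : N → ℝ
  dhi : N → ℝ
  /-- lower and upper thermal limits of the lines -/
  Plo : N → N → ℝ
  Phi : N → N → ℝ

namespace PowerSystem

variable {N : Type*} [Fintype N] [DecidableEq N] (S : PowerSystem N)

/-- The lines that connect two buses of the same control area. -/
def Ein : Finset (N × N) := S.E.filter fun e => S.area e.1 = S.area e.2

/-- Net power leaving bus `i` through the lines: `∑_{j : ij ∈ E} P_ij - ∑_{k : ki ∈ E} P_ki`. -/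
noncomputable def netFlow (P : S.E → ℝ) (i : N) : ℝ :=
  (∑ e : S.E with e.1.1 = i, P e) - ∑ e : S.E with e.1.2 = i, P e

/-- Virtual power flow `B_ij (ψ_i - ψ_j)` on the line `e = ij`. -/
noncomputable def virtLine (ψ : N → ℝ) (e : N × N) : ℝ := S.B e.1 e.2 * (ψ e.1 - ψ e.2)

/-- Net virtual power leaving bus `i` through the lines inside its control area:
`∑_{j : ij ∈ E_in} B_ij (ψ_i - ψ_j) - ∑_{k : ki ∈ E_in} B_ki (ψ_k - ψ_i)`. -/
noncomputable def virtFlow (ψ : N → ℝ) (i : N) : ℝ :=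
  (∑ e : S.Ein with e.1.1 = i, S.virtLine ψ e.1) - ∑ e : S.Ein with e.1.2 = i, S.virtLine ψ e.1

/-- Constraints of the optimal load control problem (over loads `d` and phase angles `θ`). -/
def OLCFeasible (d θ : N → ℝ) : Prop :=
  (∀ i, d i = S.Pin i - S.virtFlow θ i) ∧
  (∀ i, S.dlo i ≤ d i ∧ d i ≤ S.dhi i) ∧
  (∀ e ∈ S.Ein, S.Plo e.1 e.2 ≤ S.virtLine θ e ∧ S.virtLine θ e ≤ S.Phi e.1 e.2)

/-- Constraints of the reformulated optimal load control problem. -/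
def OPFeasible (d ω : N → ℝ) (P : S.E → ℝ) (ψ : N → ℝ) : Prop :=
  (∀ i, d i = S.Pin i - S.D i * ω i - S.netFlow P i) ∧
  (∀ i, S.dlo i ≤ d i ∧ d i ≤ S.dhi i) ∧
  (∀ i, d i = S.Pin i - S.virtFlow ψ i) ∧
  (∀ e ∈ S.Ein, S.Plo e.1 e.2 ≤ S.virtLine ψ e ∧ S.virtLine ψ e ≤ S.Phi e.1 e.2)

/-- Objective of the reformulated optimal load control problem. -/
noncomputable def opObjective (d ω : N → ℝ) : ℝ :=
  (∑ i, S.c i (d i)) + ∑ i, 1 / 2 * S.D i * ω i ^ 2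

/-- `(d, ω, P, ψ)` is an optimal solution of the reformulated optimal load control problem. -/
def OPOptimal (d ω : N → ℝ) (P : S.E → ℝ) (ψ : N → ℝ) : Prop :=
  S.OPFeasible d ω P ψ ∧
  ∀ (d' ω' : N → ℝ) (P' : S.E → ℝ) (ψ' : N → ℝ),
    S.OPFeasible d' ω' P' ψ' → S.opObjective d ω ≤ S.opObjective d' ω'

/-- The least damping coefficient (the network has finitely many, and at least one, buses). -/
noncomputable def Dmin : ℝ := ⨅ i, S.D i

/-- State of the closed loop. -/
structure State where
  d : N → ℝ
  ω : N → ℝ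
  P : S.E → ℝ
  ψ : N → ℝ
  γp : N → ℝ
  γm : N → ℝ
  r : N → ℝ
  σp : S.Ein → ℝ
  σm : S.Ein → ℝ

/-- Convergence of a trajectory to a point as time tends to infinity. -/
def ConvergesTo (x : ℝ → S.State) (y : S.State) : Prop :=
  Tendsto (fun t => (x t).d) atTop (𝓝 y.d) ∧
  Tendsto (fun t => (x t).ω) atTop (𝓝 y.ω) ∧
  Tendsto (fun t => (x t).P) atTop (𝓝 y.P) ∧
  Tendsto (fun t => (x t).ψ) atTop (𝓝 y.ψ) ∧
  Tendsto (fun t => (x t).γp) atTop (𝓝 y.γp) ∧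
  Tendsto (fun t => (x t).γm) atTop (𝓝 y.γm) ∧
  Tendsto (fun t => (x t).r) atTop (𝓝 y.r) ∧
  Tendsto (fun t => (x t).σp) atTop (𝓝 y.σp) ∧
  Tendsto (fun t => (x t).σm) atTop (𝓝 y.σm)

end PowerSystem

/-- Positive projection `[x]⁺_y`: it is `x` if `x > 0` or `y > 0`, and `0` otherwise. -/
noncomputable def posProj (x y : ℝ) : ℝ := open Classical in if 0 < x ∨ 0 < y then x else 0

/-- `x` solves `ẋ = v` on `[0, ∞)` in the sense of Carathéodory (`x` is locally absolutely
continuous with derivative `v` almost everywhere), in integrated form.  The right-hand sides of the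
projected dynamics are discontinuous, so that solutions differentiable everywhere need not exist. -/
def SolvesODE (x v : ℝ → ℝ) : Prop :=
  ∀ t, 0 ≤ t → IntervalIntegrable v volume 0 t ∧ x t = x 0 + ∫ s in (0 : ℝ)..t, v s

/-- Positive gains and step sizes of the automatic load control algorithm. -/
structure ALCGains {N : Type*} [Fintype N] [DecidableEq N] (S : PowerSystem N) where
  K : N → ℝ
  εμ : N → ℝ
  εψ : N → ℝ
  εγp : N → ℝ
  εγm : N → ℝ
  εσp : S.Ein → ℝ
  εσm : S.Ein → ℝ
  K_pos : ∀ i, 0 < K i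
  εμ_pos : ∀ i, 0 < εμ i
  εψ_pos : ∀ i, 0 < εψ i
  εγp_pos : ∀ i, 0 < εγp i
  εγm_pos : ∀ i, 0 < εγm i
  εσp_pos : ∀ e, 0 < εσp e
  εσm_pos : ∀ e, 0 < εσm e

namespace ALCGains

variable {N : Type*} [Fintype N] [DecidableEq N] {S : PowerSystem N} (g : ALCGains S)

/-- The step size `ε_{ω_i} = 1 / M_i` at a generator bus. -/
noncomputable def εω (_g : ALCGains S) (i : N) : ℝ := 1 / S.M i

/-- The coefficient `η_i` of the frequency in the load update. -/
noncomputable def η (i : N) : ℝ := if i ∈ S.G then (g.εω i + g.εμ i) / g.εω i else 1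

/-- The abbreviation `μ_i`, as a function of frequency and of the controller variable `r`. -/
noncomputable def μ (x : S.State) (i : N) : ℝ :=
  if i ∈ S.G then g.εμ i / g.εω i * x.ω i + g.εμ i / g.K i * x.r i else g.εμ i / g.K i * x.r i

/-- The closed loop of the network dynamics with the automatic load control algorithm on `[0, ∞)`,
where the load update is made instantaneously (infinite step size), and the controller uses the
damping coefficients `Dt` in place of the true ones. -/
structure IsTrajectory (Dt : N → ℝ) (x : ℝ → S.State) : Prop where
  /-- frequency dynamics at generator buses -/
  gen : ∀ i ∈ S.G, SolvesODE (fun t => (x t).ω i) fun t =>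
    -(S.D i * (x t).ω i + (x t).d i - S.Pin i + S.netFlow (x t).P i) / S.M i
  /-- power balance at load buses -/
  load : ∀ i ∉ S.G, ∀ t, 0 ≤ t →
    0 = S.D i * (x t).ω i + (x t).d i - S.Pin i + S.netFlow (x t).P i
  /-- line flow dynamics -/
  flow : ∀ e : S.E, SolvesODE (fun t => (x t).P e) fun t =>
    S.B e.1.1 e.1.2 * ((x t).ω e.1.1 - (x t).ω e.1.2)
  /-- instantaneous load update -/
  update : ∀ i, ∀ t, 0 ≤ t →
    -deriv (S.c i) ((x t).d i) + g.η i * (x t).ω i + g.εμ i / g.K i * (x t).r i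
      - (x t).γp i + (x t).γm i = 0
  virt : ∀ i, SolvesODE (fun t => (x t).ψ i) fun t =>
    g.εψ i *
      ((∑ e : S.Ein with e.1.1 = i,
          (g.μ (x t) i - g.μ (x t) e.1.2 - (x t).σp e + (x t).σm e) * S.B e.1.1 e.1.2)
        + ∑ e : S.Ein with e.1.2 = i,
          (g.μ (x t) i - g.μ (x t) e.1.1 + (x t).σp e - (x t).σm e) * S.B e.1.1 e.1.2)
  gammap : ∀ i, SolvesODE (fun t => (x t).γp i) fun t =>
    g.εγp i * posProj ((x t).d i - S.dhi i) ((x t).γp i)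
  gammam : ∀ i, SolvesODE (fun t => (x t).γm i) fun t =>
    g.εγm i * posProj (-(x t).d i + S.dlo i) ((x t).γm i)
  rdyn : ∀ i, SolvesODE (fun t => (x t).r i) fun t =>
    g.K i * (Dt i * (x t).ω i + S.netFlow (x t).P i - S.virtFlow (x t).ψ i)
  sigmap : ∀ e : S.Ein, SolvesODE (fun t => (x t).σp e) fun t =>
    g.εσp e * posProj (S.virtLine (x t).ψ e.1 - S.Phi e.1.1 e.1.2) ((x t).σp e)
  sigmam : ∀ e : S.Ein, SolvesODE (fun t => (x t).σm e) fun t =>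
    g.εσm e * posProj (-S.virtLine (x t).ψ e.1 + S.Plo e.1.1 e.1.2) ((x t).σm e)

end ALCGains

/-!
Since the loads never reach their limits, the multipliers `γ` stay zero, and in the variables
`(ω, P, ψ, μ, σ)` the closed loop is the primal-dual gradient flow of the load control problem with
the load limits dropped: descent in `(P, ψ)`, projected ascent in `(ω, μ, σ)`, with load bus
frequencies eliminated by the power balance (`ALCGains.IsReducedFlow`). The error in the damping
coefficients perturbs the velocity of `μ i` by a multiple of `ω i`, which does not move the
equilibria because these have zero frequency.

Equilibria exist (`PowerSystem.exists_isEquilibrium`): the cost is minimized over the compact set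
of admissible virtual line flows, and Farkas' lemma provides multipliers for the thermal limits.
The weighted squared distance to an equilibrium (`ALCGains.lyapunov`) decreases along the flow.
All interconnection terms cancel from its derivative, up to complementarity products of the right
sign, and what is left is at each bus a quadratic form in the deviations of frequency and price.
The interval allowed for the damping error is where its discriminant has the right sign
(`exists_dissipation`).

All signals are therefore bounded and Lipschitz, and Barbalat's lemma (`SolvesODE.tendsto_zero`)
shows that frequencies tend to zero, that prices, hence loads, tend to those of the equilibrium, and
that both power balances hold asymptotically. This does not yet give convergence of the line flows,
phase angles and thermal multipliers, of which an equilibrium has many; but it shows that any limit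
point is again an equilibrium (`ALCGains.IsReducedFlow.exists_limit_isEquilibrium`). The Lyapunov
function centred at that limit point is antitone and takes arbitrarily small values, so it tends to
zero. The limiting loads minimize the cost without the load limits and, as limits, respect them, so
they are optimal.
-/

/-! ### Calculus of Carathéodory solutions -/

namespace SolvesODE

variable {x y v w : ℝ → ℝ}

lemma intervalIntegrable (h : SolvesODE x v) {s t : ℝ} (hs : 0 ≤ s) (ht : 0 ≤ t) :
    IntervalIntegrable v volume s t :=
  (h s hs).1.symm.trans (h t ht).1

lemma sub_eq_integral (h : SolvesODE x v) {s t : ℝ} (hs : 0 ≤ s) (ht : 0 ≤ t) :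
    x t - x s = ∫ τ in s..t, v τ := by
  rw [(h t ht).2, (h s hs).2,
    ← intervalIntegral.integral_add_adjacent_intervals (h s hs).1 (h.intervalIntegrable hs ht)]
  ring

lemma congr (h : SolvesODE x v) (hx : ∀ t, 0 ≤ t → x t = y t) (hv : ∀ t, 0 ≤ t → v t = w t) :
    SolvesODE y w := by
  intro t ht
  have hEq : Set.EqOn v w (Set.uIcc 0 t) := fun s hs => hv s (by
    rw [Set.uIcc_of_le ht] at hs; exact hs.1)
  refine ⟨(h t ht).1.congr (fun s hs => hEq (Set.uIoc_subset_uIcc hs)), ?_⟩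
  rw [← hx t ht, ← hx 0 le_rfl, ← intervalIntegral.integral_congr hEq]
  exact (h t ht).2

lemma add (hx : SolvesODE x v) (hy : SolvesODE y w) :
    SolvesODE (fun t => x t + y t) (fun t => v t + w t) := by
  intro t ht
  refine ⟨(hx t ht).1.add (hy t ht).1, ?_⟩
  rw [intervalIntegral.integral_add (hx t ht).1 (hy t ht).1]
  have h1 := (hx t ht).2
  have h2 := (hy t ht).2
  linarith

lemma const_mul (hx : SolvesODE x v) (a : ℝ) :
    SolvesODE (fun t => a * x t) (fun t => a * v t) := by
  intro t ht
  refine ⟨(hx t ht).1.const_mul a, ?_⟩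
  have h1 := (hx t ht).2
  rw [intervalIntegral.integral_const_mul, ← mul_add, ← h1]

lemma const (a : ℝ) : SolvesODE (fun _ => a) (fun _ => 0) := by
  intro t _
  simp

lemma sum {ι : Type*} {s : Finset ι} {x v : ι → ℝ → ℝ} (h : ∀ i ∈ s, SolvesODE (x i) (v i)) :
    SolvesODE (fun t => ∑ i ∈ s, x i t) (fun t => ∑ i ∈ s, v i t) := by
  induction s using Finset.cons_induction with
  | empty => simpa using const 0
  | cons a s ha ih =>
    simp only [Finset.sum_cons]
    exact (h a (Finset.mem_cons_self a s)).add (ih fun i hi => h i (Finset.mem_cons_of_mem hi))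

lemma continuousOn (h : SolvesODE x v) : ContinuousOn x (Set.Ici 0) := by
  intro t ht
  have h1 : ContinuousOn x (Set.Icc 0 (t + 1)) := by
    have ht0 : (0 : ℝ) ≤ t + 1 := by linarith [Set.mem_Ici.1 ht]
    have h2 : ContinuousOn (fun s => ∫ τ in (0 : ℝ)..s, v τ) (Set.uIcc 0 (t + 1)) :=
      intervalIntegral.continuousOn_primitive_interval' (h _ ht0).1 Set.left_mem_uIcc
    rw [Set.uIcc_of_le ht0] at h2
    exact (continuousOn_const.add h2).congr fun s hs => (h s hs.1).2
  refine (h1 t ⟨ht, by linarith⟩).mono_of_mem_nhdsWithin ?_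
  rw [mem_nhdsWithin]
  exact ⟨Set.Iio (t + 1), isOpen_Iio, by simp, fun s hs => ⟨hs.2, hs.1.le⟩⟩

/-- The product rule for locally absolutely continuous functions, for a square. -/
lemma sub_sq (h : SolvesODE x v) (a : ℝ) :
    SolvesODE (fun t => (x t - a) ^ 2) (fun t => 2 * ((x t - a) * v t)) := by
  intro t ht
  have hx : ContinuousOn (fun s => x s - a) (Set.uIcc 0 t) := by
    rw [Set.uIcc_of_le ht]
    exact (h.continuousOn.mono fun s hs => hs.1).sub continuousOn_const
  have hv := (h t ht).1
  refine ⟨(hv.continuousOn_mul hx).const_mul 2, ?_⟩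
  have hac := hv.absolutelyContinuousOnInterval_intervalIntegral (c := 0) Set.left_mem_uIcc
  have hprod := hac.integral_deriv_mul_eq_sub hac
  have hint : ∫ s in (0 : ℝ)..t, 2 * ((x s - a) * v s) =
      ∫ s in (0 : ℝ)..t, (2 * (x 0 - a) * v s +
        (deriv (fun s => ∫ τ in (0 : ℝ)..s, v τ) s * (∫ τ in (0 : ℝ)..s, v τ) +
        (∫ τ in (0 : ℝ)..s, v τ) * deriv (fun s => ∫ τ in (0 : ℝ)..s, v τ) s)) := by
    refine intervalIntegral.integral_congr_ae ?_
    filter_upwards [hv.ae_hasDerivAt_integral] with s hs hmem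
    have hmem' := Set.uIoc_subset_uIcc hmem
    rw [(hs hmem' 0 Set.left_mem_uIcc).deriv]
    rw [Set.uIcc_of_le ht] at hmem'
    rw [(h s hmem'.1).2]
    ring
  have hdv := hac.intervalIntegrable_deriv
  rw [hint, intervalIntegral.integral_add (hv.const_mul _)
    ((hdv.mul_continuousOn hac.continuousOn).add (hdv.continuousOn_mul hac.continuousOn)), hprod,
    intervalIntegral.integral_const_mul]
  simp only [intervalIntegral.integral_same]
  rw [(h t ht).2]
  ring

lemma antitone_of_nonpos (h : SolvesODE x v) {s t : ℝ} (hs : 0 ≤ s) (hst : s ≤ t)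
    (hv : ∀ τ, s ≤ τ → τ ≤ t → v τ ≤ 0) : x t ≤ x s := by
  have h1 := h.sub_eq_integral hs (hs.trans hst)
  have h2 : 0 ≤ ∫ τ in s..t, -v τ :=
    intervalIntegral.integral_nonneg hst fun τ hτ => neg_nonneg.2 (hv τ hτ.1 hτ.2)
  rw [intervalIntegral.integral_neg] at h2
  linarith

/-- A solution that starts nonnegative stays so, if it cannot decrease while negative. -/
lemma nonneg (h : SolvesODE x v) (h0 : 0 ≤ x 0) (hv : ∀ t, 0 ≤ t → x t < 0 → 0 ≤ v t) {t : ℝ}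
    (ht : 0 ≤ t) : 0 ≤ x t := by
  by_contra! hneg
  -- the last time before `t` at which `x` is nonnegative
  have hcl : IsCompact {s | s ∈ Set.Icc 0 t ∧ x s ∈ Set.Ici 0} := by
    refine isCompact_Icc.of_isClosed_subset ?_ fun s hs => hs.1
    exact (h.continuousOn.mono fun s hs => hs.1).preimage_isClosed_of_isClosed isClosed_Icc
      isClosed_Ici
  obtain ⟨s, ⟨hs, hxs⟩, hmax⟩ := hcl.exists_isGreatest ⟨0, ⟨le_rfl, ht⟩, h0⟩
  have hsub := h.sub_eq_integral hs.1 ht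
  have hint : 0 ≤ ∫ τ in s..t, v τ := by
    refine intervalIntegral.integral_nonneg_of_ae_restrict hs.2 ?_
    filter_upwards [ae_restrict_mem measurableSet_Icc,
      ae_restrict_of_ae (Measure.ae_ne volume s)] with τ hτ hne
    refine hv τ (hs.1.trans hτ.1) ?_
    by_contra! hc
    exact hne (le_antisymm (hmax ⟨⟨hs.1.trans hτ.1, hτ.2⟩, hc⟩) hτ.1)
  have := Set.mem_Ici.1 hxs
  linarith

end SolvesODE

/-! ### Bounded and Lipschitz signals, and Barbalat's lemma -/

/-- `f` is bounded on `[0, ∞)`. -/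
def BddFwd (f : ℝ → ℝ) : Prop := ∃ C, ∀ t, 0 ≤ t → |f t| ≤ C

/-- `f` is Lipschitz on `[0, ∞)`. -/
def LipFwd (f : ℝ → ℝ) : Prop := ∃ C, ∀ s t, 0 ≤ s → 0 ≤ t → |f t - f s| ≤ C * |t - s|

namespace BddFwd

variable {f h : ℝ → ℝ}

lemma const (a : ℝ) : BddFwd fun _ => a := ⟨|a|, fun _ _ => le_rfl⟩

lemma mono (hf : BddFwd f) (hle : ∀ t, 0 ≤ t → |h t| ≤ |f t|) : BddFwd h :=
  let ⟨C, hC⟩ := hf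
  ⟨C, fun t ht => (hle t ht).trans (hC t ht)⟩

lemma add (hf : BddFwd f) (hh : BddFwd h) : BddFwd fun t => f t + h t := by
  obtain ⟨A, hA⟩ := hf
  obtain ⟨B, hB⟩ := hh
  exact ⟨A + B, fun t ht => (abs_add_le _ _).trans (add_le_add (hA t ht) (hB t ht))⟩

lemma mul (hf : BddFwd f) (hh : BddFwd h) : BddFwd fun t => f t * h t := by
  obtain ⟨A, hA⟩ := hf
  obtain ⟨B, hB⟩ := hh
  refine ⟨A * B, fun t ht => ?_⟩
  rw [abs_mul]
  exact mul_le_mul (hA t ht) (hB t ht) (abs_nonneg _) ((abs_nonneg _).trans (hA t ht))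

lemma const_mul (a : ℝ) (hf : BddFwd f) : BddFwd fun t => a * f t := (const a).mul hf

lemma neg (hf : BddFwd f) : BddFwd fun t => -f t := hf.mono fun t _ => (abs_neg (f t)).le

lemma sub (hf : BddFwd f) (hh : BddFwd h) : BddFwd fun t => f t - h t := by
  simpa only [sub_eq_add_neg] using hf.add hh.neg

lemma sum {ι : Type*} {s : Finset ι} {f : ι → ℝ → ℝ} (hf : ∀ i ∈ s, BddFwd (f i)) :
    BddFwd fun t => ∑ i ∈ s, f i t := by
  induction s using Finset.cons_induction with
  | empty => simpa using const 0
  | cons a s ha ih =>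
    simp only [Finset.sum_cons]
    exact (hf a (Finset.mem_cons_self a s)).add (ih fun i hi => hf i (Finset.mem_cons_of_mem hi))

lemma of_sq_le {C : ℝ} {a : ℝ} (hf : ∀ t, 0 ≤ t → (f t - a) ^ 2 ≤ C) : BddFwd f := by
  refine ⟨|a| + (C + 1), fun t ht => ?_⟩
  have h1 : |f t - a| ≤ C + 1 := by
    have := hf t ht
    rw [← sq_abs] at this
    nlinarith [sq_nonneg (|f t - a| - 1)]
  calc |f t| = |a + (f t - a)| := by ring_nf
    _ ≤ |a| + |f t - a| := abs_add_le _ _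
    _ ≤ _ := by linarith

/-- A bounded signal converges along any ultrafilter of arbitrarily late times. -/
lemma exists_tendsto (hf : BddFwd f) {U : Ultrafilter ℝ} (hU : (U : Filter ℝ) ≤ atTop) :
    ∃ a, Tendsto f U (𝓝 a) := by
  obtain ⟨C, hC⟩ := hf
  have hmem : ∀ᶠ t in (U : Filter ℝ), f t ∈ Set.Icc (-C) C :=
    hU ((eventually_ge_atTop 0).mono fun t ht => abs_le.1 (hC t ht))
  obtain ⟨a, -, ha⟩ := isCompact_Icc.ultrafilter_le_nhds (U.map f) (le_principal_iff.2 hmem)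
  exact ⟨a, ha⟩

end BddFwd

namespace LipFwd

variable {f h : ℝ → ℝ}

lemma const (a : ℝ) : LipFwd fun _ => a := ⟨0, fun _ _ _ _ => by simp⟩

lemma add (hf : LipFwd f) (hh : LipFwd h) : LipFwd fun t => f t + h t := by
  obtain ⟨A, hA⟩ := hf
  obtain ⟨B, hB⟩ := hh
  refine ⟨A + B, fun s t hs ht => ?_⟩
  calc |f t + h t - (f s + h s)| = |(f t - f s) + (h t - h s)| := by ring_nf
    _ ≤ |f t - f s| + |h t - h s| := abs_add_le _ _
    _ ≤ A * |t - s| + B * |t - s| := add_le_add (hA s t hs ht) (hB s t hs ht)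
    _ = _ := by ring

lemma const_mul (a : ℝ) (hf : LipFwd f) : LipFwd fun t => a * f t := by
  obtain ⟨A, hA⟩ := hf
  refine ⟨|a| * A, fun s t hs ht => ?_⟩
  rw [← mul_sub, abs_mul, mul_assoc]
  exact mul_le_mul_of_nonneg_left (hA s t hs ht) (abs_nonneg a)

lemma mul_const (hf : LipFwd f) (a : ℝ) : LipFwd fun t => f t * a := by
  simpa only [mul_comm] using hf.const_mul a

lemma neg (hf : LipFwd f) : LipFwd fun t => -f t := by
  simpa only [neg_one_mul] using hf.const_mul (-1)

lemma sub (hf : LipFwd f) (hh : LipFwd h) : LipFwd fun t => f t - h t := by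
  simpa only [sub_eq_add_neg] using hf.add hh.neg

lemma sum {ι : Type*} {s : Finset ι} {f : ι → ℝ → ℝ} (hf : ∀ i ∈ s, LipFwd (f i)) :
    LipFwd fun t => ∑ i ∈ s, f i t := by
  induction s using Finset.cons_induction with
  | empty => simpa using const 0
  | cons a s ha ih =>
    simp only [Finset.sum_cons]
    exact (hf a (Finset.mem_cons_self a s)).add (ih fun i hi => hf i (Finset.mem_cons_of_mem hi))

lemma sq (hf : LipFwd f) (hb : BddFwd f) : LipFwd fun t => f t ^ 2 := by
  obtain ⟨A, hA⟩ := hf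
  obtain ⟨B, hB⟩ := hb
  refine ⟨2 * B * A, fun s t hs ht => ?_⟩
  have h1 : |f t + f s| ≤ 2 * B := (abs_add_le _ _).trans (by linarith [hB s hs, hB t ht])
  calc |f t ^ 2 - f s ^ 2| = |f t + f s| * |f t - f s| := by rw [← abs_mul]; ring_nf
    _ ≤ (2 * B) * (A * |t - s|) :=
      mul_le_mul h1 (hA s t hs ht) (abs_nonneg _) ((abs_nonneg _).trans h1)
    _ = _ := by ring

/-- The Lipschitz constant may be taken nonnegative. -/
lemma exists_nonneg (hf : LipFwd f) :
    ∃ C, 0 ≤ C ∧ ∀ s t, 0 ≤ s → 0 ≤ t → |f t - f s| ≤ C * |t - s| := by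
  obtain ⟨C, hC⟩ := hf
  exact ⟨|C|, abs_nonneg C, fun s t hs ht =>
    (hC s t hs ht).trans (mul_le_mul_of_nonneg_right (le_abs_self C) (abs_nonneg _))⟩

lemma continuousOn (hf : LipFwd f) : ContinuousOn f (Set.Ici 0) := by
  obtain ⟨C, hC0, hC⟩ := hf.exists_nonneg
  refine (LipschitzOnWith.of_dist_le_mul (K := ⟨C, hC0⟩) fun t ht s hs => ?_).continuousOn
  exact hC s t hs ht

lemma solvesODE_integral (hf : LipFwd f) : SolvesODE (fun t => ∫ τ in (0 : ℝ)..t, f τ) f := by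
  intro t ht
  refine ⟨ContinuousOn.intervalIntegrable ?_, by simp⟩
  rw [Set.uIcc_of_le ht]
  exact hf.continuousOn.mono fun s hs => hs.1

end LipFwd

lemma SolvesODE.lipFwd {x v : ℝ → ℝ} (h : SolvesODE x v) (hv : BddFwd v) : LipFwd x := by
  obtain ⟨C, hC⟩ := hv
  refine ⟨C, fun s t hs ht => ?_⟩
  rw [h.sub_eq_integral hs ht]
  refine intervalIntegral.norm_integral_le_of_norm_le_const (f := v) fun τ hτ => hC τ ?_
  rcases Set.mem_uIoc.1 hτ with h1 | h1
  · exact hs.trans h1.1.le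
  · exact ht.trans h1.1.le

/-- **Barbalat's lemma**: if `x` converges and its derivative is Lipschitz, then the derivative
tends to zero. -/
lemma SolvesODE.tendsto_zero {x v : ℝ → ℝ} {a : ℝ} (h : SolvesODE x v) (hv : LipFwd v)
    (hx : Tendsto x atTop (𝓝 a)) : Tendsto v atTop (𝓝 0) := by
  obtain ⟨C, hC0, hC⟩ := hv.exists_nonneg
  rw [Metric.tendsto_atTop]
  intro ε hε
  obtain ⟨δ, hδ, hδε⟩ : ∃ δ : ℝ, 0 < δ ∧ C * δ < ε / 2 := by
    refine ⟨ε / (2 * (C + 1)), by positivity, ?_⟩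
    rw [mul_div_assoc', div_lt_div_iff₀ (by positivity) two_pos]
    nlinarith
  -- a forward difference quotient of `x` tends to zero, and is within `C * δ` of `v`
  have hdiff : Tendsto (fun t => x (t + δ) - x t) atTop (𝓝 0) := by
    simpa using (hx.comp (tendsto_atTop_add_const_right atTop δ tendsto_id)).sub hx
  obtain ⟨T, hT⟩ := (Metric.tendsto_atTop.1 hdiff) (δ * (ε / 2)) (by positivity)
  refine ⟨max T 0, fun t ht => ?_⟩
  have ht0 : 0 ≤ t := (le_max_right _ _).trans ht
  have h1 := hT t ((le_max_left _ _).trans ht)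
  rw [Real.dist_eq, sub_zero] at h1 ⊢
  have hsub := h.sub_eq_integral ht0 (by linarith : 0 ≤ t + δ)
  have h2 : |(∫ τ in t..t + δ, v τ) - δ * v t| ≤ C * δ * δ := by
    have hi := h.intervalIntegrable ht0 (by linarith : 0 ≤ t + δ)
    have h3 : (∫ τ in t..t + δ, v τ) - δ * v t = ∫ τ in t..t + δ, (v τ - v t) := by
      rw [intervalIntegral.integral_sub hi intervalIntegrable_const,
        intervalIntegral.integral_const]
      simp
    rw [h3]
    have h4 : ∀ τ ∈ Set.uIoc t (t + δ), ‖v τ - v t‖ ≤ C * δ := by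
      intro τ hτ
      rw [Set.uIoc_of_le (by linarith)] at hτ
      refine (hC t τ ht0 (ht0.trans hτ.1.le)).trans (mul_le_mul_of_nonneg_left ?_ hC0)
      rw [abs_le]
      constructor <;> linarith [hτ.1, hτ.2]
    simpa [abs_of_pos hδ] using intervalIntegral.norm_integral_le_of_norm_le_const h4
  rw [← hsub] at h2
  have h5 : δ * |v t| < δ * ε := by
    calc δ * |v t| = |δ * v t| := by rw [abs_mul, abs_of_pos hδ]
      _ = |(x (t + δ) - x t) - ((x (t + δ) - x t) - δ * v t)| := by ring_nf
      _ ≤ |x (t + δ) - x t| + |(x (t + δ) - x t) - δ * v t| := abs_sub _ _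
      _ < δ * (ε / 2) + δ * (ε / 2) := by nlinarith
      _ = δ * ε := by ring
  exact lt_of_mul_lt_mul_left h5 hδ.le

/-- A Lipschitz dissipation rate of a nonnegative storage function tends to zero. -/
lemma SolvesODE.tendsto_zero_of_dissipation {U W f : ℝ → ℝ} (h : SolvesODE U W)
    (hU : ∀ t, 0 ≤ t → 0 ≤ U t) (hf : LipFwd f) (hf0 : ∀ t, 0 ≤ t → 0 ≤ f t)
    (hW : ∀ t, 0 ≤ t → W t ≤ -f t) : Tendsto f atTop (𝓝 0) := by
  have hI := hf.solvesODE_integral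
  -- past time zero the integral of `f` increases, and it is bounded by `U 0`
  have hmono : Monotone fun t => ∫ τ in (0 : ℝ)..max t 0, f τ := by
    intro s t hst
    have := (hI.const_mul (-1)).antitone_of_nonpos (le_max_right s 0) (max_le_max_right 0 hst)
      fun τ hτ _ => by linarith [hf0 τ ((le_max_right s 0).trans hτ)]
    simp only at this ⊢
    linarith
  have hbdd : ∀ t, ∫ τ in (0 : ℝ)..max t 0, f τ ≤ U 0 := by
    intro t
    have := (h.add hI).antitone_of_nonpos le_rfl (le_max_right t 0)
      fun τ hτ _ => by linarith [hW τ hτ]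
    simp only [intervalIntegral.integral_same, add_zero] at this
    linarith [hU _ (le_max_right t 0)]
  refine hI.tendsto_zero hf
    ((tendsto_atTop_ciSup hmono ⟨U 0, by rintro _ ⟨t, rfl⟩; exact hbdd t⟩).congr' ?_)
  filter_upwards [eventually_ge_atTop 0] with t ht
  rw [max_eq_left ht]

/-! ### Farkas' lemma -/

/-- **Farkas' lemma** for finitely many linear functionals, by induction on their number. -/
lemma exists_nonneg_sum_eq_of_forall_le {V ι : Type*} [AddCommGroup V] [Module ℝ V]
    (s : Finset ι) (a : ι → V →ₗ[ℝ] ℝ) (b : V →ₗ[ℝ] ℝ)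
    (h : ∀ x, (∀ i ∈ s, a i x ≤ 0) → b x ≤ 0) :
    ∃ c : ι → ℝ, (∀ i, 0 ≤ c i) ∧ ∀ x, b x = ∑ i ∈ s, c i * a i x := by
  classical
  induction s using Finset.induction_on generalizing a b with
  | empty =>
    refine ⟨0, fun _ => le_rfl, fun x => ?_⟩
    have h1 := h x (by simp)
    have h2 := h (-x) (by simp)
    rw [map_neg] at h2
    rw [Finset.sum_empty]
    linarith
  | insert k s hk ih =>
    by_cases hs : ∀ x, (∀ i ∈ s, a i x ≤ 0) → b x ≤ 0
    · obtain ⟨c, hc, hb⟩ := ih a b hs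
      refine ⟨fun i => if i = k then 0 else c i, fun i => ?_, fun x => ?_⟩
      · dsimp only
        split_ifs
        exacts [le_rfl, hc i]
      · rw [Finset.sum_insert hk, hb x]
        dsimp only
        rw [if_pos rfl, zero_mul, zero_add]
        exact Finset.sum_congr rfl fun i hi => by rw [if_neg (ne_of_mem_of_not_mem hi hk)]
    · push Not at hs
      obtain ⟨z, hz, hbz⟩ := hs
      have hkz : 0 < a k z := by
        by_contra! hle
        refine hbz.not_ge (h z fun i hi => ?_)
        rcases Finset.mem_insert.1 hi with rfl | hi
        exacts [hle, hz i hi]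
      -- project along `z` onto the kernel of `a k`
      obtain ⟨c, hc, hb⟩ := ih (fun i => a i - (a i z / a k z) • a k)
        (b - (b z / a k z) • a k) (by
          intro x hx
          have h1 := h (x - (a k x / a k z) • z) (by
            intro i hi
            rcases Finset.mem_insert.1 hi with rfl | hi
            · simp [div_mul_cancel₀ _ hkz.ne']
            · have := hx i hi
              simp only [LinearMap.sub_apply, LinearMap.smul_apply, smul_eq_mul] at this
              simp only [map_sub, map_smul, smul_eq_mul]
              calc _ = _ := by ring
                _ ≤ _ := this)
          simp only [map_sub, map_smul, smul_eq_mul] at h1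
          simp only [LinearMap.sub_apply, LinearMap.smul_apply, smul_eq_mul]
          calc _ = _ := by ring
            _ ≤ _ := h1)
      refine ⟨fun i => if i = k then (b z - ∑ j ∈ s, c j * a j z) / a k z else c i,
        fun i => ?_, fun x => ?_⟩
      · dsimp only
        split_ifs
        · refine div_nonneg (sub_nonneg.2 (le_trans ?_ hbz.le)) hkz.le
          exact Finset.sum_nonpos fun j hj => mul_nonpos_of_nonneg_of_nonpos (hc j) (hz j hj)
        · exact hc i
      · have h1 := hb x
        simp only [LinearMap.sub_apply, LinearMap.smul_apply, smul_eq_mul] at h1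
        have h2 : ∑ i ∈ s, c i * (a i x - a i z / a k z * a k x) =
            ∑ i ∈ s, c i * a i x - (∑ i ∈ s, c i * a i z) / a k z * a k x := by
          rw [Finset.sum_div, Finset.sum_mul, ← Finset.sum_sub_distrib]
          exact Finset.sum_congr rfl fun i _ => by ring
        rw [h2] at h1
        have h3 : ∀ i ∈ s, (if i = k then (b z - ∑ j ∈ s, c j * a j z) / a k z else c i) * a i x =
            c i * a i x := fun i hi => by rw [if_neg (ne_of_mem_of_not_mem hi hk)]
        rw [Finset.sum_insert hk, Finset.sum_congr rfl h3]
        dsimp only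
        rw [if_pos rfl, sub_eq_iff_eq_add.1 h1]
        ring

/-! ### Network identities -/

namespace PowerSystem

section NetOut

variable {N : Type*} [DecidableEq N]

/-- Net outflow at bus `i` of a flow `p` on the lines in `A`; `netFlow` and `virtFlow` are the
instances `A = E` and `A = E_in`. -/
noncomputable def netOut {A : Finset (N × N)} (p : A → ℝ) (i : N) : ℝ :=
  (∑ e : A with e.1.1 = i, p e) - ∑ e : A with e.1.2 = i, p e

lemma sum_mul_sum_fiber [Fintype N] {A : Finset (N × N)} (p : A → ℝ) (w : N → ℝ) (f : A → N) :
    ∑ i, w i * ∑ e : A with f e = i, p e = ∑ e, p e * w (f e) := by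
  rw [← Finset.sum_fiberwise Finset.univ f fun e => p e * w (f e)]
  refine Finset.sum_congr rfl fun i _ => ?_
  rw [Finset.mul_sum]
  refine Finset.sum_congr rfl fun e he => ?_
  rw [(Finset.mem_filter.1 he).2, mul_comm]

/-- Net outflow is adjoint to the difference along lines. -/
lemma sum_mul_netOut [Fintype N] {A : Finset (N × N)} (p : A → ℝ) (w : N → ℝ) :
    ∑ i, w i * netOut p i = ∑ e : A, p e * (w e.1.1 - w e.1.2) := by
  simp only [netOut, mul_sub, Finset.sum_sub_distrib]
  rw [sum_mul_sum_fiber p w fun e => e.1.1, sum_mul_sum_fiber p w fun e => e.1.2]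

lemma netOut_sub {A : Finset (N × N)} (p q : A → ℝ) (i : N) :
    netOut (fun e => p e - q e) i = netOut p i - netOut q i := by
  simp only [netOut, Finset.sum_sub_distrib]
  ring

lemma tendsto_netOut {α : Type*} {l : Filter α} {A : Finset (N × N)} {p : α → A → ℝ} {q : A → ℝ}
    (h : ∀ e, Tendsto (fun a => p a e) l (𝓝 (q e))) (i : N) :
    Tendsto (fun a => netOut (p a) i) l (𝓝 (netOut q i)) :=
  (tendsto_finsetSum _ fun e _ => h e).sub (tendsto_finsetSum _ fun e _ => h e)

lemma lipFwd_netOut {A : Finset (N × N)} {p : ℝ → A → ℝ} (h : ∀ e, LipFwd fun t => p t e) (i : N) :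
    LipFwd fun t => netOut (p t) i :=
  (LipFwd.sum fun e _ => h e).sub (LipFwd.sum fun e _ => h e)

lemma bddFwd_netOut {A : Finset (N × N)} {p : ℝ → A → ℝ} (h : ∀ e, BddFwd fun t => p t e) (i : N) :
    BddFwd fun t => netOut (p t) i :=
  (BddFwd.sum fun e _ => h e).sub (BddFwd.sum fun e _ => h e)

lemma solvesODE_netOut {A : Finset (N × N)} {p v : ℝ → A → ℝ}
    (h : ∀ e, SolvesODE (fun t => p t e) fun t => v t e) (i : N) :
    SolvesODE (fun t => netOut (p t) i) fun t => netOut (v t) i := by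
  have h1 := (SolvesODE.sum (s := Finset.univ.filter fun e : A => e.1.1 = i) fun e _ => h e).add
    ((SolvesODE.sum (s := Finset.univ.filter fun e : A => e.1.2 = i) fun e _ => h e).const_mul (-1))
  refine h1.congr (fun t _ => ?_) (fun t _ => ?_) <;> (rw [netOut]; ring)

end NetOut

variable {N : Type*} [Fintype N] [DecidableEq N] {S : PowerSystem N}

lemma netFlow_eq_netOut (P : S.E → ℝ) (i : N) : S.netFlow P i = netOut P i := rfl

lemma virtFlow_eq_netOut (ψ : N → ℝ) (i : N) :
    S.virtFlow ψ i = netOut (fun e : S.Ein => S.virtLine ψ e.1) i := rfl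

lemma mem_E_of_mem_Ein {e : N × N} (he : e ∈ S.Ein) : e ∈ S.E := Finset.filter_subset _ _ he

lemma B_pos_of_mem_Ein (e : S.Ein) : 0 < S.B e.1.1 e.1.2 :=
  S.B_pos _ _ (mem_E_of_mem_Ein e.2)

lemma virtLine_sub (ψ φ : N → ℝ) (e : N × N) :
    S.virtLine (fun i => ψ i - φ i) e = S.virtLine ψ e - S.virtLine φ e := by
  simp only [virtLine]
  ring

lemma virtFlow_sub (ψ φ : N → ℝ) (i : N) :
    S.virtFlow (fun i => ψ i - φ i) i = S.virtFlow ψ i - S.virtFlow φ i := by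
  simp only [virtFlow_eq_netOut, virtLine_sub, netOut_sub]

lemma sum_mul_virtFlow (ψ w : N → ℝ) :
    ∑ i, w i * S.virtFlow ψ i = ∑ e : S.Ein, S.virtLine ψ e.1 * (w e.1.1 - w e.1.2) :=
  sum_mul_netOut _ w

lemma virtLine_eq_zero_of_virtFlow_eq_zero {ψ : N → ℝ} (h : ∀ i, S.virtFlow ψ i = 0)
    (e : S.Ein) : S.virtLine ψ e.1 = 0 := by
  have h1 := S.sum_mul_virtFlow ψ ψ
  simp only [h, mul_zero, Finset.sum_const_zero] at h1
  have h2 : ∀ e ∈ (Finset.univ : Finset S.Ein), 0 ≤ S.virtLine ψ e.1 * (ψ e.1.1 - ψ e.1.2) := by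
    intro e _
    rw [virtLine, mul_assoc]
    exact mul_nonneg (B_pos_of_mem_Ein e).le (mul_self_nonneg _)
  have h3 := (Finset.sum_eq_zero_iff_of_nonneg h2).1 h1.symm e (Finset.mem_univ e)
  rcases mul_eq_zero.1 h3 with h4 | h4
  · exact h4
  · rw [virtLine, h4, mul_zero]

/-- The net virtual flow determines the virtual line flows. -/
lemma virtLine_eq_of_virtFlow_eq {ψ φ : N → ℝ} (h : ∀ i, S.virtFlow ψ i = S.virtFlow φ i)
    (e : S.Ein) : S.virtLine ψ e.1 = S.virtLine φ e.1 := by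
  have h1 := virtLine_eq_zero_of_virtFlow_eq_zero (S := S) (ψ := fun i => ψ i - φ i)
    (fun i => by rw [virtFlow_sub, h i, sub_self]) e
  rw [virtLine_sub] at h1
  linarith

/-- Weighted variant of the injectivity of the Laplacian on the flows it comes from: if scaling a
net outflow by positive weights gives phase angles without virtual flow, the net outflow is zero. -/
lemma netOut_eq_zero_of_virtFlow_mul_eq_zero {w : S.Ein → ℝ} {ε : N → ℝ} (hε : ∀ i, 0 < ε i)
    (h : ∀ i, S.virtFlow (fun i => ε i * netOut w i) i = 0) (i : N) : netOut w i = 0 := by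
  have h1 := sum_mul_netOut w fun i => ε i * netOut w i
  have h2 : ∀ e : S.Ein, ε e.1.1 * netOut w e.1.1 - ε e.1.2 * netOut w e.1.2 = 0 := by
    intro e
    have := virtLine_eq_zero_of_virtFlow_eq_zero h e
    rw [virtLine] at this
    exact (mul_eq_zero.1 this).resolve_left (B_pos_of_mem_Ein e).ne'
  simp only [h2, mul_zero, Finset.sum_const_zero] at h1
  have h3 : ∀ i ∈ (Finset.univ : Finset N), 0 ≤ ε i * netOut w i * netOut w i := by
    intro i _
    rw [mul_assoc]
    exact mul_nonneg (hε i).le (mul_self_nonneg _)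
  have h4 := (Finset.sum_eq_zero_iff_of_nonneg h3).1 h1 i (Finset.mem_univ i)
  rw [mul_assoc] at h4
  exact mul_self_eq_zero.1 ((mul_eq_zero.1 h4).resolve_left (hε i).ne')

/-! ### Equilibria of the closed loop -/

variable (S)

/-- Driving term of the virtual phase angles on a line: the negative gradient, with respect to the
phase difference, of the Lagrangian in which `μ` are the multipliers of the virtual balance
equations and `σp`, `σm` those of the thermal limits. -/
noncomputable def angleForce (μ : N → ℝ) (σp σm : S.Ein → ℝ) (e : S.Ein) : ℝ :=
  S.B e.1.1 e.1.2 * (μ e.1.1 - μ e.1.2 - σp e + σm e)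

/-- The stationary points of the closed loop at which the frequency is zero and the load limits are
inactive (`γ = 0`), in terms of `μ` instead of `r`. They are the points that satisfy the
Karush-Kuhn-Tucker conditions of the load control problem with the load limits dropped. -/
structure IsEquilibrium (d : N → ℝ) (P : S.E → ℝ) (ψ μ : N → ℝ) (σp σm : S.Ein → ℝ) : Prop where
  netFlow_eq : ∀ i, S.netFlow P i = S.Pin i - d i
  virtFlow_eq : ∀ i, S.virtFlow ψ i = S.Pin i - d i
  deriv_cost : ∀ i, deriv (S.c i) (d i) = μ i
  stationary : ∀ i, netOut (S.angleForce μ σp σm) i = 0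
  σp_nonneg : ∀ e, 0 ≤ σp e
  σm_nonneg : ∀ e, 0 ≤ σm e
  le_Phi : ∀ e : S.Ein, S.virtLine ψ e.1 ≤ S.Phi e.1.1 e.1.2
  Plo_le : ∀ e : S.Ein, S.Plo e.1.1 e.1.2 ≤ S.virtLine ψ e.1
  compl_σp : ∀ e : S.Ein, σp e * (S.Phi e.1.1 e.1.2 - S.virtLine ψ e.1) = 0
  compl_σm : ∀ e : S.Ein, σm e * (S.virtLine ψ e.1 - S.Plo e.1.1 e.1.2) = 0

/-- The thermal limits, as a condition on the phase angles. -/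
def ThermalFeasible (ψ : N → ℝ) : Prop :=
  ∀ e ∈ S.Ein, S.Plo e.1 e.2 ≤ S.virtLine ψ e ∧ S.virtLine ψ e ≤ S.Phi e.1 e.2

/-- The virtual line flows, as a linear map of the phase angles. -/
noncomputable def virtLineₗ : (N → ℝ) →ₗ[ℝ] (S.Ein → ℝ) where
  toFun ψ e := S.virtLine ψ e.1
  map_add' ψ φ := by
    ext e
    simp only [virtLine, Pi.add_apply]
    ring
  map_smul' a ψ := by
    ext e
    simp only [virtLine, Pi.smul_apply, smul_eq_mul, RingHom.id_apply]
    ring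

variable {S}

/-- The cost of load adjustment attains its minimum under the thermal limits: although phase angles
range over an unbounded set, the line flows they induce range over a compact one. -/
lemma exists_min_cost (hc : ∀ i, Differentiable ℝ (S.c i)) (hfeas : ∃ θ, S.ThermalFeasible θ) :
    ∃ θ, S.ThermalFeasible θ ∧ ∀ φ, S.ThermalFeasible φ →
      ∑ i, S.c i (S.Pin i - S.virtFlow θ i) ≤ ∑ i, S.c i (S.Pin i - S.virtFlow φ i) := by
  let Q : Set (S.Ein → ℝ) := Set.Icc (fun e => S.Plo e.1.1 e.1.2) (fun e => S.Phi e.1.1 e.1.2) ∩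
    (LinearMap.range S.virtLineₗ : Set (S.Ein → ℝ))
  have hQ : IsCompact Q :=
    isCompact_Icc.inter_right (Submodule.closed_of_finiteDimensional (LinearMap.range S.virtLineₗ))
  have hmem : ∀ φ, S.ThermalFeasible φ → S.virtLineₗ φ ∈ Q := fun φ hφ =>
    ⟨⟨fun e => (hφ e.1 e.2).1, fun e => (hφ e.1 e.2).2⟩, φ, rfl⟩
  have hcont : Continuous fun q : S.Ein → ℝ => ∑ i, S.c i (S.Pin i - netOut q i) := by
    refine continuous_finsetSum _ fun i _ => (hc i).continuous.comp (continuous_const.sub ?_)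
    exact (continuous_finsetSum _ fun e _ => continuous_apply e).sub
      (continuous_finsetSum _ fun e _ => continuous_apply e)
  obtain ⟨θ₀, hθ₀⟩ := hfeas
  obtain ⟨q, ⟨hq, θ, rfl⟩, hmin⟩ := hQ.exists_isMinOn ⟨_, hmem θ₀ hθ₀⟩ hcont.continuousOn
  exact ⟨θ, fun e he => ⟨hq.1 ⟨e, he⟩, hq.2 ⟨e, he⟩⟩, fun φ hφ => hmin (hmem φ hφ)⟩

/-- First-order optimality: moving a minimizer in a direction that does not violate the active
thermal limits does not decrease the cost. -/
lemma sum_deriv_mul_virtFlow_nonpos (hc : ∀ i, Differentiable ℝ (S.c i)) {θ : N → ℝ}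
    (hθ : S.ThermalFeasible θ) (hmin : ∀ φ, S.ThermalFeasible φ →
      ∑ i, S.c i (S.Pin i - S.virtFlow θ i) ≤ ∑ i, S.c i (S.Pin i - S.virtFlow φ i))
    {φ : N → ℝ}
    (hp : ∀ e : S.Ein, S.virtLine θ e.1 = S.Phi e.1.1 e.1.2 → S.virtLine φ e.1 ≤ 0)
    (hm : ∀ e : S.Ein, S.virtLine θ e.1 = S.Plo e.1.1 e.1.2 → 0 ≤ S.virtLine φ e.1) :
    ∑ i, deriv (S.c i) (S.Pin i - S.virtFlow θ i) * S.virtFlow φ i ≤ 0 := by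
  have hline : ∀ (s : ℝ) (e : N × N),
      S.virtLine (fun i => θ i - (-s) * φ i) e = S.virtLine θ e + s * S.virtLine φ e := by
    intro s e
    simp only [virtLine]
    ring
  have hflow : ∀ (s : ℝ) (i : N),
      S.virtFlow (fun i => θ i - (-s) * φ i) i = S.virtFlow θ i + s * S.virtFlow φ i := by
    intro s i
    simp only [virtFlow, hline, Finset.sum_add_distrib, ← Finset.mul_sum]
    ring
  have hder : HasDerivAt (fun s : ℝ => ∑ i, S.c i (S.Pin i - (S.virtFlow θ i + s * S.virtFlow φ i)))
      (∑ i, deriv (S.c i) (S.Pin i - S.virtFlow θ i) * (-S.virtFlow φ i)) 0 := by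
    refine HasDerivAt.fun_sum fun i _ => ?_
    have h1 : HasDerivAt (fun s : ℝ => S.Pin i - (S.virtFlow θ i + s * S.virtFlow φ i))
        (-S.virtFlow φ i) 0 := by
      simpa using (((hasDerivAt_id (0 : ℝ)).mul_const (S.virtFlow φ i)).const_add
        (S.virtFlow θ i)).const_sub (S.Pin i)
    have h2 : HasDerivAt (S.c i) (deriv (S.c i) (S.Pin i - S.virtFlow θ i))
        (S.Pin i - (S.virtFlow θ i + 0 * S.virtFlow φ i)) := by
      simpa using (hc i (S.Pin i - S.virtFlow θ i)).hasDerivAt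
    exact h2.comp (0 : ℝ) h1
  have hfeas : ∀ᶠ s : ℝ in 𝓝[>] 0, S.ThermalFeasible fun i => θ i - (-s) * φ i := by
    have hlim : ∀ e : S.Ein, Tendsto (fun s : ℝ => S.virtLine θ e.1 + s * S.virtLine φ e.1) (𝓝[>] 0)
        (𝓝 (S.virtLine θ e.1)) := by
      intro e
      have : Continuous fun s : ℝ => S.virtLine θ e.1 + s * S.virtLine φ e.1 := by fun_prop
      simpa using (this.tendsto 0).mono_left nhdsWithin_le_nhds
    have hone : ∀ e : S.Ein, ∀ᶠ s : ℝ in 𝓝[>] 0,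
        S.Plo e.1.1 e.1.2 ≤ S.virtLine θ e.1 + s * S.virtLine φ e.1 ∧
        S.virtLine θ e.1 + s * S.virtLine φ e.1 ≤ S.Phi e.1.1 e.1.2 := by
      intro e
      refine Filter.Eventually.and ?_ ?_
      · rcases (hθ e.1 e.2).1.lt_or_eq with h | h
        · exact ((hlim e).eventually_const_lt h).mono fun s hs => hs.le
        · filter_upwards [self_mem_nhdsWithin] with s hs
          linarith [mul_nonneg (Set.mem_Ioi.1 hs).le (hm e h.symm)]
      · rcases (hθ e.1 e.2).2.lt_or_eq with h | h
        · exact ((hlim e).eventually_lt_const h).mono fun s hs => hs.le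
        · filter_upwards [self_mem_nhdsWithin] with s hs
          linarith [mul_nonpos_of_nonneg_of_nonpos (Set.mem_Ioi.1 hs).le (hp e h)]
    filter_upwards [eventually_all.2 hone] with s hs e he
    rw [hline]
    exact hs ⟨e, he⟩
  have hge : 0 ≤ ∑ i, deriv (S.c i) (S.Pin i - S.virtFlow θ i) * (-S.virtFlow φ i) := by
    refine ge_of_tendsto hder.tendsto_slope_zero_right ?_
    filter_upwards [hfeas, self_mem_nhdsWithin] with s hs hs0
    have h1 := hmin _ hs
    simp only [hflow] at h1
    simp only [zero_add, zero_mul, add_zero, smul_eq_mul]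
    exact mul_nonneg (inv_nonneg.2 (Set.mem_Ioi.1 hs0).le) (sub_nonneg.2 h1)
  simp only [mul_neg, Finset.sum_neg_distrib] at hge
  linarith

/-- Existence of an equilibrium; its loads minimize the cost even when the load limits are
dropped. -/
lemma exists_isEquilibrium (hc : ∀ i, Differentiable ℝ (S.c i))
    (hfeas : ∃ θ, S.ThermalFeasible θ) :
    ∃ d P ψ μ σp σm, S.IsEquilibrium d P ψ μ σp σm ∧ ∀ φ, S.ThermalFeasible φ →
      ∑ i, S.c i (d i) ≤ ∑ i, S.c i (S.Pin i - S.virtFlow φ i) := by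
  classical
  obtain ⟨θ, hθ, hmin⟩ := exists_min_cost hc hfeas
  set μ : N → ℝ := fun i => deriv (S.c i) (S.Pin i - S.virtFlow θ i)
  -- the active thermal limits; inactive ones are encoded by the zero functional
  let lineₗ : S.Ein → (N → ℝ) →ₗ[ℝ] ℝ := fun e => (LinearMap.proj e).comp S.virtLineₗ
  have hlineₗ : ∀ e φ, lineₗ e φ = S.virtLine φ e.1 := fun _ _ => rfl
  let ap : S.Ein → ℝ := fun e => if S.virtLine θ e.1 = S.Phi e.1.1 e.1.2 then 1 else 0
  let am : S.Ein → ℝ := fun e => if S.virtLine θ e.1 = S.Plo e.1.1 e.1.2 then 1 else 0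
  let a : S.Ein ⊕ S.Ein → (N → ℝ) →ₗ[ℝ] ℝ :=
    Sum.elim (fun e => ap e • lineₗ e) (fun e => -(am e • lineₗ e))
  let b : (N → ℝ) →ₗ[ℝ] ℝ := ∑ e : S.Ein, (μ e.1.1 - μ e.1.2) • lineₗ e
  have hb : ∀ φ, b φ = ∑ e : S.Ein, S.virtLine φ e.1 * (μ e.1.1 - μ e.1.2) := by
    intro φ
    simp only [b, LinearMap.sum_apply, LinearMap.smul_apply, smul_eq_mul, hlineₗ]
    exact Finset.sum_congr rfl fun e _ => mul_comm _ _
  obtain ⟨c, hc0, hbc⟩ := exists_nonneg_sum_eq_of_forall_le Finset.univ a b (by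
    intro φ hφ
    rw [hb, ← sum_mul_virtFlow]
    refine sum_deriv_mul_virtFlow_nonpos hc hθ hmin (fun e he => ?_) (fun e he => ?_)
    · simpa [a, ap, he, hlineₗ] using hφ (Sum.inl e) (Finset.mem_univ _)
    · simpa [a, am, he, hlineₗ] using hφ (Sum.inr e) (Finset.mem_univ _))
  let σp : S.Ein → ℝ := fun e => c (Sum.inl e) * ap e
  let σm : S.Ein → ℝ := fun e => c (Sum.inr e) * am e
  have hap : ∀ e, 0 ≤ ap e := fun e => by simp only [ap]; split_ifs <;> norm_num
  have ham : ∀ e, 0 ≤ am e := fun e => by simp only [am]; split_ifs <;> norm_num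
  -- line flows inside the areas are realized by the virtual ones
  let P : S.E → ℝ := fun e => if e.1 ∈ S.Ein then S.virtLine θ e.1 else 0
  have hP : ∀ i, S.netFlow P i = S.virtFlow θ i := by
    have hsum : ∀ f : N × N → N, ∀ i, ∑ e : S.E with f e.1 = i, P e =
        ∑ e : S.Ein with f e.1 = i, S.virtLine θ e.1 := by
      intro f i
      simp only [Finset.sum_filter]
      rw [Finset.sum_coe_sort S.Ein fun e => if f e = i then S.virtLine θ e else 0,
        Finset.sum_coe_sort S.E
          fun e => if f e = i then (if e ∈ S.Ein then S.virtLine θ e else 0) else 0]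
      rw [← Finset.sum_subset (Finset.filter_subset _ _ : S.Ein ⊆ S.E)]
      · exact Finset.sum_congr rfl fun e he => by rw [if_pos he]
      · intro e _ he
        have he' : e ∉ S.Ein := he
        rw [if_neg he', ite_self]
    intro i
    rw [netFlow, virtFlow, hsum Prod.fst, hsum Prod.snd]
  refine ⟨fun i => S.Pin i - S.virtFlow θ i, P, θ, μ, σp, σm, ⟨fun i => ?_, fun i => ?_,
    fun i => rfl, ?_, fun e => mul_nonneg (hc0 _) (hap e), fun e => mul_nonneg (hc0 _) (ham e),
    fun e => (hθ e.1 e.2).2, fun e => (hθ e.1 e.2).1, fun e => ?_, fun e => ?_⟩, hmin⟩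
  · rw [hP]
    ring
  · ring
  · have hzero : ∀ φ : N → ℝ, ∑ i, φ i * netOut (S.angleForce μ σp σm) i = 0 := by
      intro φ
      rw [sum_mul_netOut]
      have h1 := hbc φ
      rw [hb, Fintype.sum_sum_type] at h1
      simp only [a, Sum.elim_inl, Sum.elim_inr, LinearMap.neg_apply, LinearMap.smul_apply,
        smul_eq_mul, hlineₗ] at h1
      rw [← sub_eq_zero, ← Finset.sum_add_distrib, ← Finset.sum_sub_distrib] at h1
      rw [← h1]
      refine Finset.sum_congr rfl fun e _ => ?_
      simp only [angleForce, virtLine, σp, σm]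
      ring
    have h2 := hzero fun i => netOut (S.angleForce μ σp σm) i
    intro i
    exact mul_self_eq_zero.1
      ((Finset.sum_eq_zero_iff_of_nonneg fun i _ => mul_self_nonneg _).1 h2 i (Finset.mem_univ i))
  · simp only [σp, ap]
    split_ifs with h
    · rw [h, sub_self, mul_zero]
    · simp
  · simp only [σm, am]
    split_ifs with h
    · rw [h, sub_self, mul_zero]
    · simp

end PowerSystem

/-! ### The closed loop as a perturbed primal-dual gradient flow -/

lemma abs_posProj_le (x y : ℝ) : |posProj x y| ≤ |x| := by
  unfold posProj
  split_ifs
  · exact le_rfl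
  · simp

/-- Replacing a projected input by the unprojected one does not decrease its pairing with the
distance to a nonnegative reference. -/
lemma sub_mul_posProj_le {x y a : ℝ} (ha : 0 ≤ a) :
    (y - a) * posProj x y ≤ (y - a) * x := by
  unfold posProj
  split_ifs with h
  · exact le_rfl
  · push Not at h
    rw [mul_zero]
    exact mul_nonneg_of_nonpos_of_nonpos (by linarith [h.2]) h.1

lemma SolvesODE.nonneg_of_posProj {x v : ℝ → ℝ} {ε : ℝ} (hε : 0 < ε)
    (h : SolvesODE x fun t => ε * posProj (v t) (x t)) (h0 : 0 ≤ x 0) {t : ℝ} (ht : 0 ≤ t) :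
    0 ≤ x t := by
  refine h.nonneg h0 (fun s _ hs => mul_nonneg hε.le ?_) ht
  unfold posProj
  split_ifs with hpos
  · exact (hpos.resolve_right hs.not_gt).le
  · exact le_rfl

/-- A projected integrator that starts at zero stays there as long as its input is negative. -/
lemma SolvesODE.eq_zero_of_posProj {x v : ℝ → ℝ} {ε : ℝ} (hε : 0 < ε)
    (h : SolvesODE x fun t => ε * posProj (v t) (x t)) (h0 : x 0 = 0)
    (hv : ∀ t, 0 ≤ t → v t < 0) {t : ℝ} (ht : 0 ≤ t) : x t = 0 := by
  refine le_antisymm ?_ (h.nonneg_of_posProj hε h0.ge ht)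
  rw [← h0]
  refine h.antitone_of_nonpos le_rfl ht fun s hs _ => mul_nonpos_of_nonneg_of_nonpos hε.le ?_
  unfold posProj
  split_ifs
  exacts [(hv s hs).le, le_rfl]

namespace ALCGains

variable {N : Type*} [Fintype N] [DecidableEq N] {S : PowerSystem N}

/-- The closed loop away from the load limits, in the variables in which it is a gradient flow:
descent in `(P, ψ)` and ascent in `(ω, μ, σ)` of the Lagrangian of the load control problem, up to
the perturbation `δ i * ω i` of the velocity of `μ i`. The loads are recovered from the marginal
costs `ω i + μ i`. -/
structure IsReducedFlow (g : ALCGains S) (δ : N → ℝ) (x : ℝ → S.State) : Prop where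
  gen : ∀ i ∈ S.G, SolvesODE (fun t => (x t).ω i) fun t =>
    (S.M i)⁻¹ * (S.Pin i - (x t).d i - S.D i * (x t).ω i - S.netFlow (x t).P i)
  load : ∀ i ∉ S.G, ∀ t, 0 ≤ t →
    S.Pin i - (x t).d i - S.D i * (x t).ω i - S.netFlow (x t).P i = 0
  flow : ∀ e : S.E, SolvesODE (fun t => (x t).P e) fun t =>
    S.B e.1.1 e.1.2 * ((x t).ω e.1.1 - (x t).ω e.1.2)
  price : ∀ i, SolvesODE (fun t => g.μ (x t) i) fun t =>
    g.εμ i * (S.Pin i - (x t).d i + δ i * (x t).ω i - S.virtFlow (x t).ψ i)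
  marginal : ∀ i t, 0 ≤ t → deriv (S.c i) ((x t).d i) = (x t).ω i + g.μ (x t) i
  angle : ∀ i, SolvesODE (fun t => (x t).ψ i) fun t =>
    g.εψ i * PowerSystem.netOut (S.angleForce (g.μ (x t)) (x t).σp (x t).σm) i
  sigmap : ∀ e : S.Ein, SolvesODE (fun t => (x t).σp e) fun t =>
    g.εσp e * posProj (S.virtLine (x t).ψ e.1 - S.Phi e.1.1 e.1.2) ((x t).σp e)
  sigmam : ∀ e : S.Ein, SolvesODE (fun t => (x t).σm e) fun t =>
    g.εσm e * posProj (-S.virtLine (x t).ψ e.1 + S.Plo e.1.1 e.1.2) ((x t).σm e)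
  σp_nonneg : ∀ e t, 0 ≤ t → 0 ≤ (x t).σp e
  σm_nonneg : ∀ e t, 0 ≤ t → 0 ≤ (x t).σm e
  bdd_d : ∀ i, BddFwd fun t => (x t).d i

variable {g : ALCGains S} {δ : N → ℝ} {x : ℝ → S.State}

lemma IsTrajectory.gamma_eq_zero {Dt : N → ℝ} (hx : g.IsTrajectory Dt x)
    (hγ0 : ∀ i, (x 0).γp i = 0 ∧ (x 0).γm i = 0)
    (hd : ∀ t, 0 ≤ t → ∀ i, S.dlo i < (x t).d i ∧ (x t).d i < S.dhi i) {t : ℝ} (ht : 0 ≤ t)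
    (i : N) : (x t).γp i = 0 ∧ (x t).γm i = 0 :=
  ⟨(hx.gammap i).eq_zero_of_posProj (g.εγp_pos i) (hγ0 i).1
      (fun s hs => by linarith [(hd s hs i).2]) ht,
    (hx.gammam i).eq_zero_of_posProj (g.εγm_pos i) (hγ0 i).2
      (fun s hs => by linarith [(hd s hs i).1]) ht⟩

lemma IsTrajectory.isReducedFlow (hx : g.IsTrajectory (fun i => S.D i + δ i) x)
    (hγ0 : ∀ i, (x 0).γp i = 0 ∧ (x 0).γm i = 0)
    (hσ0 : ∀ e, 0 ≤ (x 0).σp e ∧ 0 ≤ (x 0).σm e)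
    (hd : ∀ t, 0 ≤ t → ∀ i, S.dlo i < (x t).d i ∧ (x t).d i < S.dhi i) :
    g.IsReducedFlow δ x where
  gen i hi := (hx.gen i hi).congr (fun _ _ => rfl) fun t _ => by ring
  load i hi t ht := by linarith [hx.load i hi t ht]
  flow := hx.flow
  price i := by
    have hK := (g.K_pos i).ne'
    by_cases hi : i ∈ S.G
    · have hM := (S.M_pos i hi).ne'
      refine (((hx.gen i hi).const_mul (g.εμ i / g.εω i)).add
        ((hx.rdyn i).const_mul (g.εμ i / g.K i))).congr (fun t _ => ?_) fun t _ => ?_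
      · simp only [μ, if_pos hi]
      · simp only [εω]
        field_simp
        ring
    · refine ((hx.rdyn i).const_mul (g.εμ i / g.K i)).congr (fun t _ => ?_) fun t ht => ?_
      · simp only [μ, if_neg hi]
      · have h1 : S.netFlow (x t).P i = S.Pin i - (x t).d i - S.D i * (x t).ω i := by
          linarith [hx.load i hi t ht]
        rw [h1]
        field_simp
        ring
  marginal i t ht := by
    have h1 := hx.update i t ht
    rw [(hx.gamma_eq_zero hγ0 hd ht i).1, (hx.gamma_eq_zero hγ0 hd ht i).2] at h1
    by_cases hi : i ∈ S.G
    · have hM := (S.M_pos i hi).ne'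
      simp only [η, μ, if_pos hi, εω] at h1 ⊢
      have h2 : (1 / S.M i + g.εμ i) / (1 / S.M i) = 1 + g.εμ i / (1 / S.M i) := by field_simp
      rw [h2] at h1
      linarith
    · simp only [η, μ, if_neg hi] at h1 ⊢
      linarith
  angle i := by
    refine (hx.virt i).congr (fun _ _ => rfl) fun t _ => ?_
    rw [PowerSystem.netOut, sub_eq_add_neg, ← Finset.sum_neg_distrib]
    congr 2
    · refine Finset.sum_congr rfl fun e he => ?_
      rw [PowerSystem.angleForce, (Finset.mem_filter.1 he).2, mul_comm]
    · refine Finset.sum_congr rfl fun e he => ?_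
      rw [PowerSystem.angleForce, (Finset.mem_filter.1 he).2]
      ring
  sigmap := hx.sigmap
  sigmam := hx.sigmam
  σp_nonneg e _ ht := (hx.sigmap e).nonneg_of_posProj (g.εσp_pos e) (hσ0 e).1 ht
  σm_nonneg e _ ht := (hx.sigmam e).nonneg_of_posProj (g.εσm_pos e) (hσ0 e).2 ht
  bdd_d i := ⟨max |S.dlo i| |S.dhi i|, fun t ht =>
    abs_le_max_abs_abs (hd t ht i).1.le (hd t ht i).2.le⟩

/-! ### The Lyapunov function -/

/-- Half the squared distance of a state to a reference point, weighted by inverse step sizes.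
Load bus frequencies do not enter: they have no dynamics of their own. -/
noncomputable def lyapunov (g : ALCGains S) (P : S.E → ℝ) (ψ μ : N → ℝ) (σp σm : S.Ein → ℝ)
    (z : S.State) : ℝ :=
  (∑ i ∈ S.G, S.M i / 2 * (z.ω i - 0) ^ 2)
    + (∑ e : S.E, (2 * S.B e.1.1 e.1.2)⁻¹ * (z.P e - P e) ^ 2)
    + (∑ i, (2 * g.εψ i)⁻¹ * (z.ψ i - ψ i) ^ 2)
    + (∑ i, (2 * g.εμ i)⁻¹ * (g.μ z i - μ i) ^ 2)
    + (∑ e, (2 * g.εσp e)⁻¹ * (z.σp e - σp e) ^ 2)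
    + ∑ e, (2 * g.εσm e)⁻¹ * (z.σm e - σm e) ^ 2

/-- The velocity of `lyapunov` along the reduced flow. -/
noncomputable def lyapunovRate (g : ALCGains S) (δ : N → ℝ) (P : S.E → ℝ) (ψ μ : N → ℝ)
    (σp σm : S.Ein → ℝ) (z : S.State) : ℝ :=
  (∑ i ∈ S.G, z.ω i * (S.Pin i - z.d i - S.D i * z.ω i - S.netFlow z.P i))
    + (∑ e : S.E, (z.P e - P e) * (z.ω e.1.1 - z.ω e.1.2))
    + (∑ i, (z.ψ i - ψ i) * PowerSystem.netOut (S.angleForce (g.μ z) z.σp z.σm) i)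
    + (∑ i, (g.μ z i - μ i) * (S.Pin i - z.d i + δ i * z.ω i - S.virtFlow z.ψ i))
    + (∑ e : S.Ein, (z.σp e - σp e) *
        posProj (S.virtLine z.ψ e.1 - S.Phi e.1.1 e.1.2) (z.σp e))
    + ∑ e : S.Ein, (z.σm e - σm e) *
        posProj (-S.virtLine z.ψ e.1 + S.Plo e.1.1 e.1.2) (z.σm e)

lemma IsReducedFlow.solvesODE_lyapunov (hx : g.IsReducedFlow δ x) (P : S.E → ℝ) (ψ μ : N → ℝ)
    (σp σm : S.Ein → ℝ) :
    SolvesODE (fun t => g.lyapunov P ψ μ σp σm (x t))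
      fun t => g.lyapunovRate δ P ψ μ σp σm (x t) := by
  have hterm : ∀ {y v : ℝ → ℝ} {ε : ℝ} (a : ℝ), 0 < ε → SolvesODE y (fun t => ε * v t) →
      SolvesODE (fun t => (2 * ε)⁻¹ * (y t - a) ^ 2) fun t => (y t - a) * v t := by
    intro y v ε a hε hy
    refine ((hy.sub_sq a).const_mul (2 * ε)⁻¹).congr (fun _ _ => rfl) fun t _ => ?_
    have := hε.ne'
    field_simp
  refine (((((SolvesODE.sum fun i hi => ?_).add (SolvesODE.sum fun e _ => ?_)).add
    (SolvesODE.sum fun i _ => ?_)).add (SolvesODE.sum fun i _ => ?_)).add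
    (SolvesODE.sum fun e _ => ?_)).add (SolvesODE.sum fun e _ => ?_)
  · refine (hterm 0 (inv_pos.2 (S.M_pos i hi)) (hx.gen i hi)).congr (fun t _ => ?_) fun t _ => ?_
    · have := (S.M_pos i hi).ne'
      field_simp
    · rw [sub_zero]
  · exact hterm (P e) (S.B_pos _ _ e.2) (hx.flow e)
  · exact hterm (ψ i) (g.εψ_pos i) (hx.angle i)
  · exact hterm (μ i) (g.εμ_pos i) (hx.price i)
  · exact hterm (σp e) (g.εσp_pos e) (hx.sigmap e)
  · exact hterm (σm e) (g.εσm_pos e) (hx.sigmam e)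

/-- The interconnection terms of the Lyapunov rate cancel; what is left is a quadratic form in
frequencies and prices at each bus, and the complementarity products of the thermal limits. -/
lemma IsReducedFlow.lyapunovRate_le (hx : g.IsReducedFlow δ x) {ds : N → ℝ} {P : S.E → ℝ}
    {ψ μ : N → ℝ} {σp σm : S.Ein → ℝ} (hs : S.IsEquilibrium ds P ψ μ σp σm) {t : ℝ} (ht : 0 ≤ t) :
    g.lyapunovRate δ P ψ μ σp σm (x t) ≤
      -(∑ i, (S.D i * (x t).ω i ^ 2 + ((x t).d i - ds i) * ((x t).ω i + (g.μ (x t) i - μ i))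
          - δ i * (x t).ω i * (g.μ (x t) i - μ i)))
        - (∑ e, (x t).σp e * (S.Phi e.1.1 e.1.2 - S.virtLine ψ e.1))
        - ∑ e, (x t).σm e * (S.virtLine ψ e.1 - S.Plo e.1.1 e.1.2) := by
  set z := x t with hz
  have hω : ∑ i ∈ S.G, z.ω i * (S.Pin i - z.d i - S.D i * z.ω i - S.netFlow z.P i) =
      ∑ i, z.ω i * (ds i - z.d i - S.D i * z.ω i) -
        ∑ e : S.E, (z.P e - P e) * (z.ω e.1.1 - z.ω e.1.2) := by
    rw [← PowerSystem.sum_mul_netOut, ← Finset.sum_sub_distrib,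
      Finset.sum_subset (Finset.subset_univ S.G)
        fun i _ hi => by rw [hx.load i hi t ht, mul_zero]]
    refine Finset.sum_congr rfl fun i _ => ?_
    rw [PowerSystem.netOut_sub, ← PowerSystem.netFlow_eq_netOut, ← PowerSystem.netFlow_eq_netOut,
      hs.netFlow_eq i]
    ring
  have hψ : ∑ i, (z.ψ i - ψ i) * PowerSystem.netOut (S.angleForce (g.μ z) z.σp z.σm) i =
      ∑ e : S.Ein, (S.virtLine z.ψ e.1 - S.virtLine ψ e.1) * ((g.μ z e.1.1 - μ e.1.1)
        - (g.μ z e.1.2 - μ e.1.2) - (z.σp e - σp e) + (z.σm e - σm e)) := by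
    have h1 : ∀ i, PowerSystem.netOut (S.angleForce (g.μ z) z.σp z.σm) i = PowerSystem.netOut
        (fun e => S.angleForce (g.μ z) z.σp z.σm e - S.angleForce μ σp σm e) i := fun i => by
      rw [PowerSystem.netOut_sub, hs.stationary i, sub_zero]
    simp only [h1]
    rw [PowerSystem.sum_mul_netOut]
    refine Finset.sum_congr rfl fun e _ => ?_
    simp only [PowerSystem.angleForce, PowerSystem.virtLine]
    ring
  have hμ : ∑ i, (g.μ z i - μ i) * (S.Pin i - z.d i + δ i * z.ω i - S.virtFlow z.ψ i) =
      ∑ i, (g.μ z i - μ i) * (ds i - z.d i + δ i * z.ω i) -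
        ∑ e : S.Ein, (S.virtLine z.ψ e.1 - S.virtLine ψ e.1) *
          ((g.μ z e.1.1 - μ e.1.1) - (g.μ z e.1.2 - μ e.1.2)) := by
    have h1 := S.sum_mul_virtFlow (fun i => z.ψ i - ψ i) fun i => g.μ z i - μ i
    simp only [PowerSystem.virtLine_sub] at h1
    rw [← h1, ← Finset.sum_sub_distrib]
    refine Finset.sum_congr rfl fun i _ => ?_
    rw [PowerSystem.virtFlow_sub, hs.virtFlow_eq i]
    ring
  have hp : ∑ e : S.Ein, (z.σp e - σp e) *
        posProj (S.virtLine z.ψ e.1 - S.Phi e.1.1 e.1.2) (z.σp e) ≤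
      ∑ e : S.Ein, ((z.σp e - σp e) * (S.virtLine z.ψ e.1 - S.virtLine ψ e.1)
        - z.σp e * (S.Phi e.1.1 e.1.2 - S.virtLine ψ e.1)) := by
    refine Finset.sum_le_sum fun e _ =>
      (sub_mul_posProj_le (hs.σp_nonneg e)).trans (le_of_eq ?_)
    linear_combination hs.compl_σp e
  have hm : ∑ e : S.Ein, (z.σm e - σm e) *
        posProj (-S.virtLine z.ψ e.1 + S.Plo e.1.1 e.1.2) (z.σm e) ≤
      ∑ e : S.Ein, (-((z.σm e - σm e) * (S.virtLine z.ψ e.1 - S.virtLine ψ e.1))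
        - z.σm e * (S.virtLine ψ e.1 - S.Plo e.1.1 e.1.2)) := by
    refine Finset.sum_le_sum fun e _ =>
      (sub_mul_posProj_le (hs.σm_nonneg e)).trans (le_of_eq ?_)
    linear_combination hs.compl_σm e
  have hquad : ∑ i, z.ω i * (ds i - z.d i - S.D i * z.ω i) +
      ∑ i, (g.μ z i - μ i) * (ds i - z.d i + δ i * z.ω i) =
      -∑ i, (S.D i * z.ω i ^ 2 + (z.d i - ds i) * (z.ω i + (g.μ z i - μ i))
          - δ i * z.ω i * (g.μ z i - μ i)) := by
    rw [← Finset.sum_add_distrib, ← Finset.sum_neg_distrib]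
    exact Finset.sum_congr rfl fun i _ => by ring
  have hcross : ∑ e : S.Ein, (S.virtLine z.ψ e.1 - S.virtLine ψ e.1) * ((g.μ z e.1.1 - μ e.1.1)
        - (g.μ z e.1.2 - μ e.1.2) - (z.σp e - σp e) + (z.σm e - σm e)) =
      ∑ e : S.Ein, (S.virtLine z.ψ e.1 - S.virtLine ψ e.1) *
          ((g.μ z e.1.1 - μ e.1.1) - (g.μ z e.1.2 - μ e.1.2))
      - ∑ e : S.Ein, (z.σp e - σp e) * (S.virtLine z.ψ e.1 - S.virtLine ψ e.1)
      + ∑ e : S.Ein, (z.σm e - σm e) * (S.virtLine z.ψ e.1 - S.virtLine ψ e.1) := by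
    rw [← Finset.sum_sub_distrib, ← Finset.sum_add_distrib]
    exact Finset.sum_congr rfl fun e _ => by ring
  rw [Finset.sum_sub_distrib] at hp hm
  rw [Finset.sum_neg_distrib] at hm
  rw [lyapunovRate]
  linarith

end ALCGains

/-! ### Positive definiteness of the dissipation -/

/-- Mean value theorem for the derivative of a function with curvature in `[u, ℓ]`. -/
lemma exists_deriv_sub_eq_mul {c : ℝ → ℝ} {u ℓ : ℝ} (hc' : Differentiable ℝ (deriv c))
    (hc'' : ∀ y, u ≤ deriv (deriv c) y ∧ deriv (deriv c) y ≤ ℓ) (a b : ℝ) :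
    ∃ k, u ≤ k ∧ k ≤ ℓ ∧ deriv c a - deriv c b = k * (a - b) := by
  have hlt : ∀ a b : ℝ, a < b → ∃ k, u ≤ k ∧ k ≤ ℓ ∧ deriv c b - deriv c a = k * (b - a) := by
    intro a b hab
    obtain ⟨y, -, hy⟩ :=
      exists_deriv_eq_slope (deriv c) hab hc'.continuous.continuousOn hc'.differentiableOn
    refine ⟨_, (hc'' y).1, (hc'' y).2, ?_⟩
    rw [hy, div_mul_cancel₀ _ (sub_pos.2 hab).ne']
  rcases lt_trichotomy a b with h | rfl | h
  · obtain ⟨k, h1, h2, h3⟩ := hlt a b h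
    exact ⟨k, h1, h2, by linarith⟩
  · exact ⟨_, (hc'' 0).1, (hc'' 0).2, by simp⟩
  · exact hlt b a h

/-- A binary quadratic form with negative discriminant is bounded below by a positive multiple of
the squared norm. -/
lemma exists_pos_mul_sq_add_sq_le {a b c : ℝ} (ha : 0 < a) (hc : 0 < c) (h : b ^ 2 < 4 * a * c) :
    ∃ α, 0 < α ∧ ∀ v m, α * (v ^ 2 + m ^ 2) ≤ a * v ^ 2 + b * (v * m) + c * m ^ 2 := by
  -- determinant over trace, a lower bound for the smaller eigenvalue
  set α := (4 * a * c - b ^ 2) / (4 * (a + c))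
  have hα0 : 0 < α := div_pos (by linarith) (by linarith)
  have hα1 : α * (4 * (a + c)) = 4 * a * c - b ^ 2 := div_mul_cancel₀ _ (by positivity)
  have hac : 0 < a - α := by
    have : α * (a + c) < a * (a + c) := by nlinarith [sq_nonneg b]
    linarith [lt_of_mul_lt_mul_right this (by linarith)]
  have hdisc : b ^ 2 ≤ 4 * (a - α) * (c - α) := by nlinarith [sq_nonneg α]
  refine ⟨α, hα0, fun v m => ?_⟩
  -- complete the square
  have h1 : 0 ≤ (a - α) * (a * v ^ 2 + b * (v * m) + c * m ^ 2 - α * (v ^ 2 + m ^ 2)) := by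
    have : (a - α) * (a * v ^ 2 + b * (v * m) + c * m ^ 2 - α * (v ^ 2 + m ^ 2)) =
        ((a - α) * v + b / 2 * m) ^ 2 + (4 * (a - α) * (c - α) - b ^ 2) / 4 * m ^ 2 := by ring
    rw [this]
    have := mul_nonneg (by linarith : 0 ≤ (4 * (a - α) * (c - α) - b ^ 2) / 4) (sq_nonneg m)
    linarith [sq_nonneg ((a - α) * v + b / 2 * m)]
  linarith [nonneg_of_mul_nonneg_right h1 hac]

/-- The range allowed for the error `δ` in the damping coefficient is the one in which the
dissipation at a bus is positive definite, uniformly in the slope of the load response. -/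
lemma exists_dissipation {c : ℝ → ℝ} {u ℓ D Dmin δ : ℝ} (hu : 0 < u) (huℓ : u ≤ ℓ)
    (hc' : Differentiable ℝ (deriv c))
    (hc'' : ∀ y, u ≤ deriv (deriv c) y ∧ deriv (deriv c) y ≤ ℓ)
    (hDmin : 0 ≤ Dmin) (hD : 0 < D) (hDD : Dmin ≤ D)
    (hδ : δ ∈ Set.Ioo (2 * (1 / ℓ - Real.sqrt ((1 / ℓ) ^ 2 + 1 / ℓ * Dmin)))
      (2 * (1 / ℓ + Real.sqrt ((1 / ℓ) ^ 2 + 1 / ℓ * Dmin)))) :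
    ∃ α, 0 < α ∧ ∀ d ds v m, deriv c d - deriv c ds = v + m →
      α * (v ^ 2 + m ^ 2) ≤ D * v ^ 2 + (d - ds) * (v + m) - δ * v * m := by
  have hκ : 0 < 1 / ℓ := one_div_pos.2 (hu.trans_le huℓ)
  set κ := 1 / ℓ with hκdef
  have hdisc : (2 * κ - δ) ^ 2 < 4 * (D + κ) * κ := by
    have h0 : 0 ≤ κ ^ 2 + κ * Dmin := by positivity
    have h1 : |δ - 2 * κ| < 2 * Real.sqrt (κ ^ 2 + κ * Dmin) := by
      rw [abs_lt]
      constructor <;> linarith [hδ.1, hδ.2]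
    have h2 : (δ - 2 * κ) ^ 2 < 4 * (κ ^ 2 + κ * Dmin) := by
      have := pow_lt_pow_left₀ h1 (abs_nonneg _) two_ne_zero
      rw [sq_abs, mul_pow, Real.sq_sqrt h0] at this
      linarith
    have h3 : κ * Dmin ≤ κ * D := mul_le_mul_of_nonneg_left hDD hκ.le
    calc (2 * κ - δ) ^ 2 = (δ - 2 * κ) ^ 2 := by ring
      _ < _ := h2
      _ ≤ 4 * (D + κ) * κ := by linarith
  obtain ⟨α, hα, hquad⟩ := exists_pos_mul_sq_add_sq_le (by positivity : 0 < D + κ) hκ hdisc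
  refine ⟨α, hα, fun d ds v m hdv => ?_⟩
  have h1 : κ * (v + m) ^ 2 ≤ (d - ds) * (v + m) := by
    obtain ⟨k, hk1, hk2, hk⟩ := exists_deriv_sub_eq_mul hc' hc'' d ds
    rw [← hdv, hk]
    have hk0 : 0 < k := hu.trans_le hk1
    have hκk : κ * k ≤ 1 := by
      rw [hκdef, one_div, inv_mul_le_iff₀ (hk0.trans_le hk2), mul_one]
      exact hk2
    calc κ * (k * (d - ds)) ^ 2 = (κ * k) * (k * (d - ds) ^ 2) := by ring
      _ ≤ 1 * (k * (d - ds) ^ 2) := mul_le_mul_of_nonneg_right hκk (by positivity)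
      _ = _ := by ring
  have h2 := hquad v m
  calc _ ≤ _ := h2
    _ = D * v ^ 2 + κ * (v + m) ^ 2 - δ * v * m := by ring
    _ ≤ _ := by linarith

/-! ### Boundedness and regularity along the flow -/

/-- At every bus, the dissipation of the Lyapunov function is a positive definite function of the
deviations `v` of the frequency and `m` of the price, whatever the loads they come from. -/
def PowerSystem.Dissipative {N : Type*} [Fintype N] [DecidableEq N] (S : PowerSystem N)
    (δ : N → ℝ) : Prop :=
  ∀ i, ∃ α, 0 < α ∧ ∀ d ds v m, deriv (S.c i) d - deriv (S.c i) ds = v + m →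
    α * (v ^ 2 + m ^ 2) ≤ S.D i * v ^ 2 + (d - ds) * (v + m) - δ i * v * m

namespace ALCGains

variable {N : Type*} [Fintype N] [DecidableEq N] {S : PowerSystem N} {g : ALCGains S}
  {δ : N → ℝ} {x : ℝ → S.State}

lemma sq_le_lyapunov (g : ALCGains S) (P : S.E → ℝ) (ψ μ : N → ℝ) (σp σm : S.Ein → ℝ)
    (z : S.State) :
    0 ≤ g.lyapunov P ψ μ σp σm z ∧
    (∀ i ∈ S.G, (z.ω i - 0) ^ 2 ≤ 2 * (S.M i)⁻¹ * g.lyapunov P ψ μ σp σm z) ∧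
    (∀ e : S.E, (z.P e - P e) ^ 2 ≤ 2 * S.B e.1.1 e.1.2 * g.lyapunov P ψ μ σp σm z) ∧
    (∀ i, (z.ψ i - ψ i) ^ 2 ≤ 2 * g.εψ i * g.lyapunov P ψ μ σp σm z) ∧
    (∀ i, (g.μ z i - μ i) ^ 2 ≤ 2 * g.εμ i * g.lyapunov P ψ μ σp σm z) ∧
    (∀ e, (z.σp e - σp e) ^ 2 ≤ 2 * g.εσp e * g.lyapunov P ψ μ σp σm z) ∧
    ∀ e, (z.σm e - σm e) ^ 2 ≤ 2 * g.εσm e * g.lyapunov P ψ μ σp σm z := by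
  have t1 : ∀ i ∈ S.G, 0 ≤ S.M i / 2 * (z.ω i - 0) ^ 2 := fun i hi =>
    mul_nonneg (half_pos (S.M_pos i hi)).le (sq_nonneg _)
  have hinv : ∀ {ε : ℝ} (y : ℝ), 0 < ε → 0 ≤ (2 * ε)⁻¹ * y ^ 2 := fun y hε => by positivity
  have t2 : ∀ e ∈ (Finset.univ : Finset S.E), 0 ≤ (2 * S.B e.1.1 e.1.2)⁻¹ * (z.P e - P e) ^ 2 :=
    fun e _ => hinv _ (S.B_pos _ _ e.2)
  have t3 : ∀ i ∈ (Finset.univ : Finset N), 0 ≤ (2 * g.εψ i)⁻¹ * (z.ψ i - ψ i) ^ 2 :=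
    fun i _ => hinv _ (g.εψ_pos i)
  have t4 : ∀ i ∈ (Finset.univ : Finset N), 0 ≤ (2 * g.εμ i)⁻¹ * (g.μ z i - μ i) ^ 2 :=
    fun i _ => hinv _ (g.εμ_pos i)
  have t5 : ∀ e ∈ (Finset.univ : Finset S.Ein), 0 ≤ (2 * g.εσp e)⁻¹ * (z.σp e - σp e) ^ 2 :=
    fun e _ => hinv _ (g.εσp_pos e)
  have t6 : ∀ e ∈ (Finset.univ : Finset S.Ein), 0 ≤ (2 * g.εσm e)⁻¹ * (z.σm e - σm e) ^ 2 :=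
    fun e _ => hinv _ (g.εσm_pos e)
  have s1 := Finset.sum_nonneg t1
  have s2 := Finset.sum_nonneg t2
  have s3 := Finset.sum_nonneg t3
  have s4 := Finset.sum_nonneg t4
  have s5 := Finset.sum_nonneg t5
  have s6 := Finset.sum_nonneg t6
  have hle : ∀ {ε y V : ℝ}, 0 < ε → (2 * ε)⁻¹ * y ≤ V → y ≤ 2 * ε * V := by
    intro ε y V hε h
    rwa [inv_mul_le_iff₀ (by positivity)] at h
  refine ⟨?_, fun i hi => hle (inv_pos.2 (S.M_pos i hi)) ?_,
    fun e => hle (S.B_pos _ _ e.2) ?_, fun i => hle (g.εψ_pos i) ?_,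
    fun i => hle (g.εμ_pos i) ?_, fun e => hle (g.εσp_pos e) ?_, fun e => hle (g.εσm_pos e) ?_⟩
  all_goals rw [lyapunov]
  · positivity
  · have h1 := Finset.single_le_sum t1 hi
    have h2 : (2 * (S.M i)⁻¹)⁻¹ = S.M i / 2 := by
      rw [mul_inv, inv_inv]
      ring
    rw [h2]
    linarith
  · linarith [Finset.single_le_sum t2 (Finset.mem_univ e)]
  · linarith [Finset.single_le_sum t3 (Finset.mem_univ i)]
  · linarith [Finset.single_le_sum t4 (Finset.mem_univ i)]
  · linarith [Finset.single_le_sum t5 (Finset.mem_univ e)]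
  · linarith [Finset.single_le_sum t6 (Finset.mem_univ e)]

namespace IsReducedFlow

variable {ds : N → ℝ} {P : S.E → ℝ} {ψ μ : N → ℝ} {σp σm : S.Ein → ℝ}

lemma exists_lyapunovRate_le (hx : g.IsReducedFlow δ x) (hs : S.IsEquilibrium ds P ψ μ σp σm)
    (hδ : S.Dissipative δ) :
    ∃ α : N → ℝ, (∀ i, 0 < α i) ∧ ∀ t, 0 ≤ t → g.lyapunovRate δ P ψ μ σp σm (x t) ≤
      -((∑ i, α i * ((x t).ω i ^ 2 + (g.μ (x t) i - μ i) ^ 2))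
        + (∑ e, (x t).σp e * (S.Phi e.1.1 e.1.2 - S.virtLine ψ e.1))
        + ∑ e, (x t).σm e * (S.virtLine ψ e.1 - S.Plo e.1.1 e.1.2)) := by
  choose α hα hquad using hδ
  refine ⟨α, hα, fun t ht => (hx.lyapunovRate_le hs ht).trans ?_⟩
  have h1 := Finset.sum_le_sum fun i (_ : i ∈ (Finset.univ : Finset N)) =>
    hquad i ((x t).d i) (ds i) ((x t).ω i) (g.μ (x t) i - μ i)
      (by rw [hx.marginal i t ht, hs.deriv_cost i]; ring)
  linarith

lemma compl_nonneg (hx : g.IsReducedFlow δ x) (hs : S.IsEquilibrium ds P ψ μ σp σm) {t : ℝ}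
    (ht : 0 ≤ t) (e : S.Ein) :
    0 ≤ (x t).σp e * (S.Phi e.1.1 e.1.2 - S.virtLine ψ e.1) ∧
    0 ≤ (x t).σm e * (S.virtLine ψ e.1 - S.Plo e.1.1 e.1.2) :=
  ⟨mul_nonneg (hx.σp_nonneg e t ht) (sub_nonneg.2 (hs.le_Phi e)),
    mul_nonneg (hx.σm_nonneg e t ht) (sub_nonneg.2 (hs.Plo_le e))⟩

lemma lyapunov_antitone (hx : g.IsReducedFlow δ x) (hs : S.IsEquilibrium ds P ψ μ σp σm)
    (hδ : S.Dissipative δ) {s t : ℝ} (h0 : 0 ≤ s) (hst : s ≤ t) :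
    g.lyapunov P ψ μ σp σm (x t) ≤ g.lyapunov P ψ μ σp σm (x s) := by
  obtain ⟨α, hα, hrate⟩ := hx.exists_lyapunovRate_le hs hδ
  refine (hx.solvesODE_lyapunov P ψ μ σp σm).antitone_of_nonpos h0 hst fun τ hτ _ => ?_
  have hτ0 := h0.trans hτ
  refine (hrate τ hτ0).trans (neg_nonpos.2 (add_nonneg (add_nonneg ?_ ?_) ?_))
  · exact Finset.sum_nonneg fun i _ => mul_nonneg (hα i).le (by positivity)
  · exact Finset.sum_nonneg fun e _ => (hx.compl_nonneg hs hτ0 e).1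
  · exact Finset.sum_nonneg fun e _ => (hx.compl_nonneg hs hτ0 e).2

lemma bddFwd (hx : g.IsReducedFlow δ x) (hs : S.IsEquilibrium ds P ψ μ σp σm)
    (hδ : S.Dissipative δ) :
    (∀ i, BddFwd fun t => (x t).ω i) ∧ (∀ e, BddFwd fun t => (x t).P e) ∧
    (∀ i, BddFwd fun t => (x t).ψ i) ∧ (∀ i, BddFwd fun t => g.μ (x t) i) ∧
    (∀ e, BddFwd fun t => (x t).σp e) ∧ ∀ e, BddFwd fun t => (x t).σm e := by
  have hle : ∀ {f : ℝ → ℝ} {a k : ℝ}, 0 < k →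
      (∀ t, (f t - a) ^ 2 ≤ k * g.lyapunov P ψ μ σp σm (x t)) → BddFwd f := fun hk h =>
    BddFwd.of_sq_le fun t ht => (h t).trans
      (mul_le_mul_of_nonneg_left (hx.lyapunov_antitone hs hδ le_rfl ht) hk.le)
  have hV := fun t => g.sq_le_lyapunov P ψ μ σp σm (x t)
  have hP : ∀ e, BddFwd fun t => (x t).P e := fun e =>
    hle (mul_pos two_pos (S.B_pos _ _ e.2)) fun t => (hV t).2.2.1 e
  refine ⟨fun i => ?_, hP, fun i => hle (mul_pos two_pos (g.εψ_pos i)) fun t => (hV t).2.2.2.1 i,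
    fun i => hle (mul_pos two_pos (g.εμ_pos i)) fun t => (hV t).2.2.2.2.1 i,
    fun e => hle (mul_pos two_pos (g.εσp_pos e)) fun t => (hV t).2.2.2.2.2.1 e,
    fun e => hle (mul_pos two_pos (g.εσm_pos e)) fun t => (hV t).2.2.2.2.2.2 e⟩
  by_cases hi : i ∈ S.G
  · exact hle (mul_pos two_pos (inv_pos.2 (S.M_pos i hi))) fun t => (hV t).2.1 i hi
  · refine ((((BddFwd.const (S.Pin i)).sub (hx.bdd_d i)).sub
      (PowerSystem.bddFwd_netOut hP i)).const_mul (S.D i)⁻¹).mono fun t ht => le_of_eq ?_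
    have h1 := hx.load i hi t ht
    rw [PowerSystem.netFlow_eq_netOut] at h1
    have h2 : (x t).ω i = (S.D i)⁻¹ * (S.Pin i - (x t).d i - PowerSystem.netOut (x t).P i) := by
      rw [eq_inv_mul_iff_mul_eq₀ (S.D_pos i).ne']
      linarith
    rw [h2]

lemma bddFwd_virtLine {ψ : ℝ → N → ℝ} (h : ∀ i, BddFwd fun t => ψ t i) (e : N × N) :
    BddFwd fun t => S.virtLine (ψ t) e := ((h e.1).sub (h e.2)).const_mul _

lemma lipFwd_virtLine {ψ : ℝ → N → ℝ} (h : ∀ i, LipFwd fun t => ψ t i) (e : N × N) :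
    LipFwd fun t => S.virtLine (ψ t) e := ((h e.1).sub (h e.2)).const_mul _

/-- At a load bus the power balance determines the frequency as a Lipschitz function of price and
net line flow, as the load responds monotonically to the marginal cost. Here `dω`, `dμ`, `dd`, `dF`
are increments, and `k` is a slope of the marginal cost. -/
lemma abs_sub_le_of_balance {D k dω dμ dd dF : ℝ} (hD : 0 < D) (hk : 0 < k)
    (h1 : D * dω = -dd - dF) (h2 : k * dd = dω + dμ) : |dω| ≤ |dμ| + D⁻¹ * |dF| := by
  have h3 : (k * D + 1) * dω = -dμ - k * dF := by linear_combination k * h1 - h2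
  have h4 : (k * D + 1) * |dω| ≤ |dμ| + k * |dF| := by
    calc (k * D + 1) * |dω| = |(k * D + 1) * dω| := by
          rw [abs_mul, abs_of_pos (by positivity : 0 < k * D + 1)]
      _ = |-dμ - k * dF| := by rw [h3]
      _ ≤ |-dμ| + |k * dF| := abs_sub _ _
      _ = _ := by rw [abs_neg, abs_mul, abs_of_pos hk]
  have h5 : |dμ| + k * |dF| ≤ (k * D + 1) * (|dμ| + D⁻¹ * |dF|) := by
    have : (k * D + 1) * (|dμ| + D⁻¹ * |dF|) =
        |dμ| + k * |dF| * (D * D⁻¹) + (k * D * |dμ| + D⁻¹ * |dF|) := by ring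
    rw [this, mul_inv_cancel₀ hD.ne', mul_one]
    have : 0 ≤ k * D * |dμ| + D⁻¹ * |dF| := by positivity
    linarith
  exact le_of_mul_le_mul_left (h4.trans h5) (by positivity)

lemma lipFwd (hx : g.IsReducedFlow δ x) (hs : S.IsEquilibrium ds P ψ μ σp σm)
    (hδ : S.Dissipative δ) {u ℓ : ℝ} (hu : 0 < u)
    (hc' : ∀ i, Differentiable ℝ (deriv (S.c i)))
    (hc'' : ∀ i y, u ≤ deriv (deriv (S.c i)) y ∧ deriv (deriv (S.c i)) y ≤ ℓ) :
    (∀ i, LipFwd fun t => (x t).d i) ∧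
    (∀ i, LipFwd fun t => (x t).ω i) ∧ (∀ e, LipFwd fun t => (x t).P e) ∧
    (∀ i, LipFwd fun t => (x t).ψ i) ∧ (∀ i, LipFwd fun t => g.μ (x t) i) ∧
    (∀ e, LipFwd fun t => (x t).σp e) ∧ ∀ e, LipFwd fun t => (x t).σm e := by
  obtain ⟨bω, bP, bψ, bμ, bp, bm⟩ := hx.bddFwd hs hδ
  have bline := fun e => bddFwd_virtLine (S := S) bψ e
  have lP : ∀ e, LipFwd fun t => (x t).P e := fun e =>
    (hx.flow e).lipFwd (((bω _).sub (bω _)).const_mul _)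
  have lψ : ∀ i, LipFwd fun t => (x t).ψ i := fun i =>
    (hx.angle i).lipFwd ((PowerSystem.bddFwd_netOut
      (fun e => ((((bμ _).sub (bμ _)).sub (bp e)).add (bm e)).const_mul _) i).const_mul _)
  have lμ : ∀ i, LipFwd fun t => g.μ (x t) i := fun i =>
    (hx.price i).lipFwd (((((BddFwd.const _).sub (hx.bdd_d i)).add ((bω i).const_mul _)).sub
      (PowerSystem.bddFwd_netOut (fun e => bline e.1) i)).const_mul _)
  have lp : ∀ e, LipFwd fun t => (x t).σp e := fun e =>
    (hx.sigmap e).lipFwd ((((bline e.1).sub (BddFwd.const _)).mono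
      fun t _ => abs_posProj_le _ _).const_mul _)
  have lm : ∀ e, LipFwd fun t => (x t).σm e := fun e =>
    (hx.sigmam e).lipFwd ((((bline e.1).neg.add (BddFwd.const _)).mono
      fun t _ => abs_posProj_le _ _).const_mul _)
  have hslope : ∀ i s t, 0 ≤ s → 0 ≤ t → ∃ k, u ≤ k ∧
      k * ((x t).d i - (x s).d i) = ((x t).ω i - (x s).ω i) + (g.μ (x t) i - g.μ (x s) i) := by
    intro i s t h0s h0t
    obtain ⟨k, hk, -, hk'⟩ := exists_deriv_sub_eq_mul (hc' i) (hc'' i) ((x t).d i) ((x s).d i)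
    refine ⟨k, hk, ?_⟩
    rw [← hk', hx.marginal i t h0t, hx.marginal i s h0s]
    ring
  have lω : ∀ i, LipFwd fun t => (x t).ω i := by
    intro i
    by_cases hi : i ∈ S.G
    · exact (hx.gen i hi).lipFwd (((((BddFwd.const _).sub (hx.bdd_d i)).sub
        ((bω i).const_mul _)).sub (PowerSystem.bddFwd_netOut bP i)).const_mul _)
    · obtain ⟨A, hA⟩ := lμ i
      obtain ⟨C, hC⟩ := PowerSystem.lipFwd_netOut lP i
      refine ⟨A + (S.D i)⁻¹ * C, fun s t h0s h0t => ?_⟩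
      obtain ⟨k, hk, hk'⟩ := hslope i s t h0s h0t
      have h1 := hx.load i hi t h0t
      have h2 := hx.load i hi s h0s
      rw [PowerSystem.netFlow_eq_netOut] at h1 h2
      refine (abs_sub_le_of_balance (dF := PowerSystem.netOut (x t).P i -
        PowerSystem.netOut (x s).P i) (S.D_pos i) (hu.trans_le hk) (by linarith) hk').trans ?_
      have h3 := mul_le_mul_of_nonneg_left (hC s t h0s h0t) (inv_pos.2 (S.D_pos i)).le
      linarith [hA s t h0s h0t]
  refine ⟨fun i => ?_, lω, lP, lψ, lμ, lp, lm⟩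
  obtain ⟨A, hA⟩ := (lω i).add (lμ i)
  refine ⟨u⁻¹ * A, fun s t h0s h0t => ?_⟩
  obtain ⟨k, hk, hk'⟩ := hslope i s t h0s h0t
  rw [mul_assoc, le_inv_mul_iff₀ hu]
  calc u * |(x t).d i - (x s).d i| ≤ k * |(x t).d i - (x s).d i| :=
        mul_le_mul_of_nonneg_right hk (abs_nonneg _)
    _ = |k * ((x t).d i - (x s).d i)| := by rw [abs_mul, abs_of_pos (hu.trans_le hk)]
    _ = |(x t).ω i + g.μ (x t) i - ((x s).ω i + g.μ (x s) i)| := by rw [hk']; ring_nf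
    _ ≤ _ := hA s t h0s h0t

/-! ### Convergence -/

lemma tendsto_of_sq_sub {α : Type*} {l : Filter α} {f h : α → ℝ} {a : ℝ}
    (hle : ∀ᶠ t in l, (f t - a) ^ 2 ≤ h t) (hh : Tendsto h l (𝓝 0)) : Tendsto f l (𝓝 a) := by
  have h1 : Tendsto (fun t => (f t - a) ^ 2) l (𝓝 0) :=
    squeeze_zero' (Eventually.of_forall fun t => sq_nonneg _) hle hh
  have h2 := h1.sqrt
  simp only [Real.sqrt_sq_eq_abs, Real.sqrt_zero] at h2
  exact tendsto_sub_nhds_zero_iff.1 ((tendsto_zero_iff_abs_tendsto_zero _).2 h2)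

/-- The dissipation vanishes asymptotically: frequencies and prices converge, and so do the
complementarity products of the thermal limits. -/
lemma tendsto_of_dissipation (hx : g.IsReducedFlow δ x) (hs : S.IsEquilibrium ds P ψ μ σp σm)
    (hδ : S.Dissipative δ) {u ℓ : ℝ} (hu : 0 < u)
    (hc' : ∀ i, Differentiable ℝ (deriv (S.c i)))
    (hc'' : ∀ i y, u ≤ deriv (deriv (S.c i)) y ∧ deriv (deriv (S.c i)) y ≤ ℓ) :
    (∀ i, Tendsto (fun t => (x t).ω i) atTop (𝓝 0)) ∧
    (∀ i, Tendsto (fun t => g.μ (x t) i) atTop (𝓝 (μ i))) ∧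
    (∀ e : S.Ein, Tendsto (fun t => (x t).σp e * (S.Phi e.1.1 e.1.2 - S.virtLine ψ e.1))
      atTop (𝓝 0)) ∧
    ∀ e : S.Ein, Tendsto (fun t => (x t).σm e * (S.virtLine ψ e.1 - S.Plo e.1.1 e.1.2))
      atTop (𝓝 0) := by
  obtain ⟨-, lω, -, -, lμ, lp, lm⟩ := hx.lipFwd hs hδ hu hc' hc''
  obtain ⟨bω, -, -, bμ, -, -⟩ := hx.bddFwd hs hδ
  obtain ⟨α, hα, hrate⟩ := hx.exists_lyapunovRate_le hs hδ
  set f₁ : N → ℝ → ℝ := fun i t => α i * ((x t).ω i ^ 2 + (g.μ (x t) i - μ i) ^ 2)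
  set f₂ : S.Ein → ℝ → ℝ :=
    fun e t => (x t).σp e * (S.Phi e.1.1 e.1.2 - S.virtLine ψ e.1)
  set f₃ : S.Ein → ℝ → ℝ :=
    fun e t => (x t).σm e * (S.virtLine ψ e.1 - S.Plo e.1.1 e.1.2)
  have h₁ : ∀ t, 0 ≤ t → ∀ i ∈ (Finset.univ : Finset N), 0 ≤ f₁ i t := fun t _ i _ =>
    mul_nonneg (hα i).le (by positivity)
  have h₂ : ∀ t, 0 ≤ t → ∀ e ∈ (Finset.univ : Finset S.Ein), 0 ≤ f₂ e t := fun t ht e _ =>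
    (hx.compl_nonneg hs ht e).1
  have h₃ : ∀ t, 0 ≤ t → ∀ e ∈ (Finset.univ : Finset S.Ein), 0 ≤ f₃ e t := fun t ht e _ =>
    (hx.compl_nonneg hs ht e).2
  have l₁ : ∀ i, LipFwd (f₁ i) := fun i => (((lω i).sq (bω i)).add
    (((lμ i).sub (LipFwd.const (μ i))).sq ((bμ i).sub (BddFwd.const _)))).const_mul _
  have l₂ : ∀ e, LipFwd (f₂ e) := fun e => (lp e).mul_const _
  have l₃ : ∀ e, LipFwd (f₃ e) := fun e => (lm e).mul_const _
  have hlim : Tendsto (fun t => (∑ i, f₁ i t) + (∑ e, f₂ e t) + ∑ e, f₃ e t) atTop (𝓝 0) :=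
    (hx.solvesODE_lyapunov P ψ μ σp σm).tendsto_zero_of_dissipation
      (fun t _ => (g.sq_le_lyapunov P ψ μ σp σm (x t)).1)
      (((LipFwd.sum fun i _ => l₁ i).add (LipFwd.sum fun e _ => l₂ e)).add
        (LipFwd.sum fun e _ => l₃ e))
      (fun t ht => add_nonneg (add_nonneg (Finset.sum_nonneg (h₁ t ht))
        (Finset.sum_nonneg (h₂ t ht))) (Finset.sum_nonneg (h₃ t ht)))
      hrate
  have hle₁ : ∀ i, ∀ᶠ t in atTop,
      f₁ i t ≤ (∑ i, f₁ i t) + (∑ e, f₂ e t) + ∑ e, f₃ e t := fun i => by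
    filter_upwards [eventually_ge_atTop 0] with t ht
    linarith [Finset.single_le_sum (h₁ t ht) (Finset.mem_univ i), Finset.sum_nonneg (h₂ t ht),
      Finset.sum_nonneg (h₃ t ht)]
  have hlim' : ∀ i, Tendsto (fun t => (α i)⁻¹ * ((∑ i, f₁ i t) + (∑ e, f₂ e t) + ∑ e, f₃ e t))
      atTop (𝓝 0) := fun i => by simpa using hlim.const_mul (α i)⁻¹
  refine ⟨fun i => tendsto_of_sq_sub ?_ (hlim' i), fun i => tendsto_of_sq_sub ?_ (hlim' i),
    fun e => squeeze_zero' ?_ ?_ hlim, fun e => squeeze_zero' ?_ ?_ hlim⟩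
  · filter_upwards [hle₁ i] with t ht
    rw [le_inv_mul_iff₀ (hα i), sub_zero]
    refine le_trans (mul_le_mul_of_nonneg_left ?_ (hα i).le) ht
    linarith [sq_nonneg (g.μ (x t) i - μ i)]
  · filter_upwards [hle₁ i] with t ht
    rw [le_inv_mul_iff₀ (hα i)]
    refine le_trans (mul_le_mul_of_nonneg_left ?_ (hα i).le) ht
    linarith [sq_nonneg ((x t).ω i)]
  · filter_upwards [eventually_ge_atTop 0] with t ht using h₂ t ht e (Finset.mem_univ e)
  · filter_upwards [eventually_ge_atTop 0] with t ht
    linarith [Finset.single_le_sum (h₂ t ht) (Finset.mem_univ e), Finset.sum_nonneg (h₁ t ht),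
      Finset.sum_nonneg (h₃ t ht)]
  · filter_upwards [eventually_ge_atTop 0] with t ht using h₃ t ht e (Finset.mem_univ e)
  · filter_upwards [eventually_ge_atTop 0] with t ht
    linarith [Finset.single_le_sum (h₃ t ht) (Finset.mem_univ e), Finset.sum_nonneg (h₁ t ht),
      Finset.sum_nonneg (h₂ t ht)]

lemma tendsto_d (hx : g.IsReducedFlow δ x) (hs : S.IsEquilibrium ds P ψ μ σp σm)
    (hδ : S.Dissipative δ) {u ℓ : ℝ} (hu : 0 < u)
    (hc' : ∀ i, Differentiable ℝ (deriv (S.c i)))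
    (hc'' : ∀ i y, u ≤ deriv (deriv (S.c i)) y ∧ deriv (deriv (S.c i)) y ≤ ℓ) (i : N) :
    Tendsto (fun t => (x t).d i) atTop (𝓝 (ds i)) := by
  obtain ⟨tω, tμ, -, -⟩ := hx.tendsto_of_dissipation hs hδ hu hc' hc''
  have h1 : Tendsto (fun t => (u ^ 2)⁻¹ * ((x t).ω i + g.μ (x t) i - μ i) ^ 2) atTop (𝓝 0) := by
    simpa using ((((tω i).add (tμ i)).sub_const (μ i)).pow 2).const_mul (u ^ 2)⁻¹
  refine tendsto_of_sq_sub ?_ h1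
  filter_upwards [eventually_ge_atTop 0] with t ht
  obtain ⟨k, hk, -, hk'⟩ := exists_deriv_sub_eq_mul (hc' i) (hc'' i) ((x t).d i) (ds i)
  rw [hx.marginal i t ht, hs.deriv_cost i] at hk'
  rw [hk', le_inv_mul_iff₀ (by positivity), mul_pow]
  exact mul_le_mul_of_nonneg_right (pow_le_pow_left₀ hu.le hk 2) (sq_nonneg _)

/-- Asymptotic power balance, real and virtual, and asymptotic stationarity of the virtual flow. -/
lemma tendsto_balance (hx : g.IsReducedFlow δ x) (hs : S.IsEquilibrium ds P ψ μ σp σm)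
    (hδ : S.Dissipative δ) {u ℓ : ℝ} (hu : 0 < u)
    (hc' : ∀ i, Differentiable ℝ (deriv (S.c i)))
    (hc'' : ∀ i y, u ≤ deriv (deriv (S.c i)) y ∧ deriv (deriv (S.c i)) y ≤ ℓ) (i : N) :
    Tendsto (fun t => S.netFlow (x t).P i) atTop (𝓝 (S.Pin i - ds i)) ∧
    Tendsto (fun t => S.virtFlow (x t).ψ i) atTop (𝓝 (S.Pin i - ds i)) ∧
    Tendsto (fun t => S.virtFlow (fun j => g.εψ j *
      PowerSystem.netOut (S.angleForce (g.μ (x t)) (x t).σp (x t).σm) j) i) atTop (𝓝 0) := by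
  obtain ⟨ld, lω, lP, lψ, lμ, lp, lm⟩ := hx.lipFwd hs hδ hu hc' hc''
  obtain ⟨tω, tμ, -, -⟩ := hx.tendsto_of_dissipation hs hδ hu hc' hc''
  have td := hx.tendsto_d hs hδ hu hc' hc'' i
  have lV : LipFwd fun t => S.virtFlow (x t).ψ i :=
    PowerSystem.lipFwd_netOut (fun e => lipFwd_virtLine lψ e.1) i
  have tV : Tendsto (fun t => S.virtFlow (x t).ψ i) atTop (𝓝 (S.Pin i - ds i)) := by
    have h1 := (hx.price i).tendsto_zero (((((LipFwd.const _).sub (ld i)).add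
      ((lω i).const_mul _)).sub lV).const_mul _) (tμ i)
    have h2 := ((td.const_sub (S.Pin i)).add ((tω i).const_mul (δ i))).sub
      (h1.const_mul (g.εμ i)⁻¹)
    simp only [mul_zero, add_zero, sub_zero] at h2
    refine h2.congr fun t => ?_
    rw [inv_mul_cancel_left₀ (g.εμ_pos i).ne']
    ring
  refine ⟨?_, tV, ?_⟩
  · by_cases hi : i ∈ S.G
    · have h1 := (hx.gen i hi).tendsto_zero (((((LipFwd.const _).sub (ld i)).sub
        ((lω i).const_mul _)).sub (PowerSystem.lipFwd_netOut lP i)).const_mul _) (tω i)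
      have h2 := ((td.const_sub (S.Pin i)).sub ((tω i).const_mul (S.D i))).sub
        (h1.const_mul (S.M i))
      simp only [mul_zero, sub_zero] at h2
      refine h2.congr fun t => ?_
      rw [mul_inv_cancel_left₀ (S.M_pos i hi).ne']
      ring
    · have h2 := (td.const_sub (S.Pin i)).sub ((tω i).const_mul (S.D i))
      simp only [mul_zero, sub_zero] at h2
      refine h2.congr' ?_
      filter_upwards [eventually_ge_atTop 0] with t ht
      linarith [hx.load i hi t ht]
  · have hode : SolvesODE (fun t => S.virtFlow (x t).ψ i) fun t => S.virtFlow (fun j => g.εψ j *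
        PowerSystem.netOut (S.angleForce (g.μ (x t)) (x t).σp (x t).σm) j) i := by
      refine PowerSystem.solvesODE_netOut (fun e => ?_) i
      refine (((hx.angle e.1.1).add ((hx.angle e.1.2).const_mul (-1))).const_mul
        (S.B e.1.1 e.1.2)).congr (fun t _ => ?_) fun t _ => ?_ <;>
      · rw [PowerSystem.virtLine]
        ring
    refine hode.tendsto_zero (PowerSystem.lipFwd_netOut (fun e => lipFwd_virtLine (fun j => ?_) e.1)
      i) tV
    exact (PowerSystem.lipFwd_netOut (fun e =>
      ((((lμ _).sub (lμ _)).sub (lp e)).add (lm e)).const_mul _) j).const_mul _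

/-- A limit along an ultrafilter is an equilibrium with the same loads and prices, and the Lyapunov
function centred at it vanishes along the ultrafilter. -/
lemma exists_limit_isEquilibrium (hx : g.IsReducedFlow δ x)
    (hs : S.IsEquilibrium ds P ψ μ σp σm) (hδ : S.Dissipative δ) {u ℓ : ℝ} (hu : 0 < u)
    (hc' : ∀ i, Differentiable ℝ (deriv (S.c i)))
    (hc'' : ∀ i y, u ≤ deriv (deriv (S.c i)) y ∧ deriv (deriv (S.c i)) y ≤ ℓ)
    {U : Ultrafilter ℝ} (hU : (U : Filter ℝ) ≤ atTop) :
    ∃ P' ψ' σp' σm', S.IsEquilibrium ds P' ψ' μ σp' σm' ∧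
      Tendsto (fun t => g.lyapunov P' ψ' μ σp' σm' (x t)) U (𝓝 0) := by
  obtain ⟨-, bP, bψ, -, bp, bm⟩ := hx.bddFwd hs hδ
  obtain ⟨tω, tμ, tp, tm⟩ := hx.tendsto_of_dissipation hs hδ hu hc' hc''
  have hbal := hx.tendsto_balance hs hδ hu hc' hc''
  choose P' hP' using fun e => (bP e).exists_tendsto hU
  choose ψ' hψ' using fun i => (bψ i).exists_tendsto hU
  choose σp' hp' using fun e => (bp e).exists_tendsto hU
  choose σm' hm' using fun e => (bm e).exists_tendsto hU
  have hpos : ∀ᶠ t in (U : Filter ℝ), 0 ≤ t := hU (eventually_ge_atTop 0)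
  have hV : ∀ i, S.virtFlow ψ' i = S.Pin i - ds i := fun i =>
    tendsto_nhds_unique (PowerSystem.tendsto_netOut
      (fun e => ((hψ' e.1.1).sub (hψ' e.1.2)).const_mul (S.B e.1.1 e.1.2)) i)
      ((hbal i).2.1.mono_left hU)
  have hline : ∀ e : S.Ein, S.virtLine ψ' e.1 = S.virtLine ψ e.1 :=
    PowerSystem.virtLine_eq_of_virtFlow_eq fun i => by rw [hV, hs.virtFlow_eq]
  have hforce : ∀ e, Tendsto (fun t => S.angleForce (g.μ (x t)) (x t).σp (x t).σm e) U
      (𝓝 (S.angleForce μ σp' σm' e)) := fun e =>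
    (((((tμ _).mono_left hU).sub ((tμ _).mono_left hU)).sub (hp' e)).add (hm' e)).const_mul _
  have hstat : ∀ i, S.virtFlow (fun j => g.εψ j *
      PowerSystem.netOut (S.angleForce μ σp' σm') j) i = 0 := fun i =>
    tendsto_nhds_unique (PowerSystem.tendsto_netOut (fun e =>
      (((PowerSystem.tendsto_netOut hforce e.1.1).const_mul (g.εψ e.1.1)).sub
        ((PowerSystem.tendsto_netOut hforce e.1.2).const_mul (g.εψ e.1.2))).const_mul
          (S.B e.1.1 e.1.2)) i) ((hbal i).2.2.mono_left hU)
  refine ⟨P', ψ', σp', σm', ⟨fun i => ?_, hV, hs.deriv_cost,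
    PowerSystem.netOut_eq_zero_of_virtFlow_mul_eq_zero g.εψ_pos hstat, fun e => ?_, fun e => ?_,
    fun e => (hline e).trans_le (hs.le_Phi e), fun e => (hs.Plo_le e).trans_eq (hline e).symm,
    fun e => ?_, fun e => ?_⟩, ?_⟩
  · exact tendsto_nhds_unique (PowerSystem.tendsto_netOut hP' i) ((hbal i).1.mono_left hU)
  · exact ge_of_tendsto (hp' e) (hpos.mono fun t ht => hx.σp_nonneg e t ht)
  · exact ge_of_tendsto (hm' e) (hpos.mono fun t ht => hx.σm_nonneg e t ht)
  · rw [hline]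
    exact tendsto_nhds_unique ((hp' e).mul_const _) ((tp e).mono_left hU)
  · rw [hline]
    exact tendsto_nhds_unique ((hm' e).mul_const _) ((tm e).mono_left hU)
  · have hsq : ∀ {f : ℝ → ℝ} {a : ℝ} (k : ℝ), Tendsto f U (𝓝 a) →
        Tendsto (fun t => k * (f t - a) ^ 2) U (𝓝 0) := by
      intro f a k hf
      simpa using ((hf.sub_const a).pow 2).const_mul k
    have hsum : ∀ {ι : Type _} {s : Finset ι} {f : ι → ℝ → ℝ},
        (∀ i ∈ s, Tendsto (f i) U (𝓝 0)) → Tendsto (fun t => ∑ i ∈ s, f i t) U (𝓝 0) := by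
      intro ι s f hf
      simpa using tendsto_finsetSum s hf
    simpa only [lyapunov, add_zero] using
      (((((hsum fun i (_ : i ∈ S.G) => hsq (S.M i / 2) ((tω i).mono_left hU)).add
      (hsum fun e (_ : e ∈ Finset.univ) => hsq (2 * S.B e.1.1 e.1.2)⁻¹ (hP' e))).add
      (hsum fun i (_ : i ∈ Finset.univ) => hsq (2 * g.εψ i)⁻¹ (hψ' i))).add
      (hsum fun i (_ : i ∈ Finset.univ) => hsq (2 * g.εμ i)⁻¹ ((tμ i).mono_left hU))).add
      (hsum fun e (_ : e ∈ Finset.univ) => hsq (2 * g.εσp e)⁻¹ (hp' e))).add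
      (hsum fun e (_ : e ∈ Finset.univ) => hsq (2 * g.εσm e)⁻¹ (hm' e))

/-- Convergence to an equilibrium: the Lyapunov function centred at a limit point decreases to
zero. -/
lemma exists_tendsto_isEquilibrium (hx : g.IsReducedFlow δ x)
    (hs : S.IsEquilibrium ds P ψ μ σp σm) (hδ : S.Dissipative δ) {u ℓ : ℝ} (hu : 0 < u)
    (hc' : ∀ i, Differentiable ℝ (deriv (S.c i)))
    (hc'' : ∀ i y, u ≤ deriv (deriv (S.c i)) y ∧ deriv (deriv (S.c i)) y ≤ ℓ) :
    ∃ P' ψ' σp' σm', S.IsEquilibrium ds P' ψ' μ σp' σm' ∧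
      Tendsto (fun t => (x t).P) atTop (𝓝 P') ∧ Tendsto (fun t => (x t).ψ) atTop (𝓝 ψ') ∧
      Tendsto (fun t => (x t).σp) atTop (𝓝 σp') ∧ Tendsto (fun t => (x t).σm) atTop (𝓝 σm') := by
  obtain ⟨P', ψ', σp', σm', hs', hlim⟩ := hx.exists_limit_isEquilibrium hs hδ hu hc' hc''
    (Ultrafilter.of_le (atTop : Filter ℝ))
  have hV := fun t => g.sq_le_lyapunov P' ψ' μ σp' σm' (x t)
  have hzero : Tendsto (fun t => g.lyapunov P' ψ' μ σp' σm' (x t)) atTop (𝓝 0) := by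
    rw [Metric.tendsto_atTop]
    intro ε hε
    obtain ⟨T, hT, hT0⟩ := ((hlim.eventually_lt_const hε).and
      (Ultrafilter.of_le (atTop : Filter ℝ) (eventually_ge_atTop 0))).exists
    refine ⟨T, fun t ht => ?_⟩
    rw [Real.dist_eq, sub_zero, abs_of_nonneg (hV t).1]
    exact (hx.lyapunov_antitone hs' hδ hT0 ht).trans_lt hT
  have hcoord : ∀ {f : ℝ → ℝ} {a : ℝ} (k : ℝ),
      (∀ t, (f t - a) ^ 2 ≤ k * g.lyapunov P' ψ' μ σp' σm' (x t)) → Tendsto f atTop (𝓝 a) :=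
    fun k h => tendsto_of_sq_sub (Eventually.of_forall h) (by simpa using hzero.const_mul k)
  exact ⟨P', ψ', σp', σm', hs',
    tendsto_pi_nhds.2 fun e => hcoord _ fun t => (hV t).2.2.1 e,
    tendsto_pi_nhds.2 fun i => hcoord _ fun t => (hV t).2.2.2.1 i,
    tendsto_pi_nhds.2 fun e => hcoord _ fun t => (hV t).2.2.2.2.2.1 e,
    tendsto_pi_nhds.2 fun e => hcoord _ fun t => (hV t).2.2.2.2.2.2 e⟩

end IsReducedFlow

lemma r_eq (g : ALCGains S) (z : S.State) (i : N) :
    z.r i = g.K i / g.εμ i * (g.μ z i - (if i ∈ S.G then g.εμ i / g.εω i else 0) * z.ω i) := by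
  have h1 := (g.K_pos i).ne'
  have h2 := (g.εμ_pos i).ne'
  by_cases hi : i ∈ S.G
  · simp only [μ, if_pos hi]
    field_simp
    ring
  · simp only [μ, if_neg hi]
    field_simp
    ring

end ALCGains

/-- Equilibria are optimal as soon as their loads respect the load limits and minimize the cost
under the thermal limits alone. -/
lemma PowerSystem.IsEquilibrium.opOptimal {N : Type*} [Fintype N] [DecidableEq N]
    {S : PowerSystem N} {d : N → ℝ} {P : S.E → ℝ} {ψ μ : N → ℝ} {σp σm : S.Ein → ℝ}
    (hs : S.IsEquilibrium d P ψ μ σp σm) (hd : ∀ i, S.dlo i ≤ d i ∧ d i ≤ S.dhi i)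
    (hmin : ∀ φ, S.ThermalFeasible φ →
      ∑ i, S.c i (d i) ≤ ∑ i, S.c i (S.Pin i - S.virtFlow φ i)) :
    S.OPOptimal d 0 P ψ := by
  refine ⟨⟨fun i => ?_, hd, fun i => ?_, fun e he => ⟨hs.Plo_le ⟨e, he⟩, hs.le_Phi ⟨e, he⟩⟩⟩, ?_⟩
  · rw [hs.netFlow_eq, Pi.zero_apply]
    ring
  · rw [hs.virtFlow_eq]
    ring
  · intro d' ω' P' ψ' ⟨_, _, hd', hψ'⟩
    have h1 := hmin ψ' hψ'
    have h2 : 0 ≤ ∑ i, 1 / 2 * S.D i * ω' i ^ 2 := Finset.sum_nonneg fun i _ => by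
      have := S.D_pos i
      positivity
    simp only [opObjective, Pi.zero_apply, ne_eq, OfNat.ofNat_ne_zero, not_false_eq_true, zero_pow,
      mul_zero, Finset.sum_const_zero, add_zero, hd']
    linarith

theorem theorem4 {N : Type*} [Fintype N] [DecidableEq N] (S : PowerSystem N) (g : ALCGains S)
    (hfeas : ∃ d θ : N → ℝ, S.OLCFeasible d θ)
    (u ℓ : ℝ) (hu : 0 < u) (huℓ : u ≤ ℓ)
    (hc : ∀ i, Differentiable ℝ (S.c i))
    (hc' : ∀ i, Differentiable ℝ (deriv (S.c i)))
    (hc'' : ∀ i y, u ≤ deriv (deriv (S.c i)) y ∧ deriv (deriv (S.c i)) y ≤ ℓ)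
    (δa : N → ℝ)
    (hδa : ∀ i, δa i ∈ Set.Ioo
      (2 * (1 / ℓ - Real.sqrt ((1 / ℓ) ^ 2 + 1 / ℓ * S.Dmin)))
      (2 * (1 / ℓ + Real.sqrt ((1 / ℓ) ^ 2 + 1 / ℓ * S.Dmin))))
    (x : ℝ → S.State)
    (hx : g.IsTrajectory (fun i => S.D i + δa i) x)
    (hγ0 : ∀ i, (x 0).γp i = 0 ∧ (x 0).γm i = 0)
    (hσ0 : ∀ e, 0 ≤ (x 0).σp e ∧ 0 ≤ (x 0).σm e)
    (hd : ∀ t, 0 ≤ t → ∀ i, S.dlo i < (x t).d i ∧ (x t).d i < S.dhi i) :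
    ∃ y : S.State, S.ConvergesTo x y ∧ S.OPOptimal y.d y.ω y.P y.ψ := by
  have hdiss : S.Dissipative δa := fun i =>
    exists_dissipation hu huℓ (hc' i) (hc'' i) (Real.iInf_nonneg fun j => (S.D_pos j).le)
      (S.D_pos i) (ciInf_le (Set.finite_range S.D).bddBelow i) (hδa i)
  have hflow := hx.isReducedFlow hγ0 hσ0 hd
  obtain ⟨d₀, θ₀, -, -, hθ₀⟩ := hfeas
  obtain ⟨ds, P₀, ψ₀, μ, σp₀, σm₀, hs, hmin⟩ := PowerSystem.exists_isEquilibrium hc ⟨θ₀, hθ₀⟩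
  obtain ⟨tω, tμ, -, -⟩ := hflow.tendsto_of_dissipation hs hdiss hu hc' hc''
  have td := hflow.tendsto_d hs hdiss hu hc' hc''
  obtain ⟨P, ψ, σp, σm, hs', tP, tψ, tp, tm⟩ :=
    hflow.exists_tendsto_isEquilibrium hs hdiss hu hc' hc''
  have hγ := fun t ht i => hx.gamma_eq_zero hγ0 hd (t := t) ht i
  refine ⟨⟨ds, 0, P, ψ, 0, 0, fun i => g.K i / g.εμ i * μ i, σp, σm⟩,
    ⟨tendsto_pi_nhds.2 td, tendsto_pi_nhds.2 tω, tP, tψ, ?_, ?_, tendsto_pi_nhds.2 fun i => ?_,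
      tp, tm⟩, hs'.opOptimal (fun i => ⟨?_, ?_⟩) hmin⟩
  · refine tendsto_const_nhds.congr' ?_
    filter_upwards [eventually_ge_atTop 0] with t ht
    exact funext fun i => (hγ t ht i).1.symm
  · refine tendsto_const_nhds.congr' ?_
    filter_upwards [eventually_ge_atTop 0] with t ht
    exact funext fun i => (hγ t ht i).2.symm
  · simp only [g.r_eq]
    simpa using ((tμ i).sub ((tω i).const_mul (if i ∈ S.G then g.εμ i / g.εω i else 0))).const_mul
      (g.K i / g.εμ i)
  · exact ge_of_tendsto (td i) ((eventually_ge_atTop 0).mono fun t ht => (hd t ht i).1.le)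
  · exact le_of_tendsto (td i) ((eventually_ge_atTop 0).mono fun t ht => (hd t ht i).2.le)
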